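/- A (turn-based stochastic) game $\mathcal G$ consists of a countable set $S$ of states, partitioned into the states $S_\Box$ of the maximizer, the states $S_\Diamond$ of the minimizer and the random states $S_\bigcirc$; a transition relation ${\longrightarrow}\subseteq S\times S$ such that every state has a successor; and, for each $s\in S_\bigcirc$, a probability distribution $P(s)$ over the successors of $s$. It is finitely branching if every state has only finitely many successors. A strategy of a player assigns to every finite sequence of states that ends in a state $s$ of this player a probability distribution over the successors of $s$; it is MD (memoryless deterministic) if this is a Dirac distribution that depends only on $s$. An initial state $s$, a maximizer strategy $\sigma$ and a minimizer strategy $\pi$ induce a probability measure $\mathcal P_{s,\sigma,\pi}$ on $S^\omega$. For $T\subseteq S$ let $\mathrm{Reach}(T)=\{s_0s_1\cdots\in S^\omega : \exists i.\ s_i\in T\}$. The value $\mathrm{val}(s)$ is the common value of $\sup_\sigma\inf_\pi\mathcal P_{s,\sigma,\pi}(\mathrm{Reach}(T))$ and $\inf_\pi\sup_\sigma\mathcal P_{s,\sigma,\pi}(\mathrm{Reach}(T))$. A transition $s\longrightarrow s'$ is value-decreasing if $\mathrm{val}(s)>\mathrm{val}(s')$, and value-increasing if $\mathrm{val}(s)<\mathrm{val}(s')$.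 Theorem. Let $\mathcal G$ be a finitely branching game, $T\subseteq S$, ${\rhd}\in\{\ge,>\}$ and $c\in[0,1]$. Suppose that at least one of the following conditions holds: (1) no transition $s\longrightarrow s'$ with $s\in S_\Box$ is value-decreasing; (2) no transition $s\longrightarrow s'$ with $s\in S_\Diamond$ is value-increasing; (3) $\rhd$ is $\ge$ and $c=1$; (4) $\rhd$ is $>$. Then the objective $(\mathrm{Reach}(T),\rhd c)$ is strongly MD-determined: for every state $s\in S$, either there is an MD strategy $\sigma$ of the maximizer such that $\mathcal P_{s,\sigma,\pi}(\mathrm{Reach}(T))\rhd c$ for all strategies $\pi$ of the minimizer, or there is an MD strategy $\pi$ of the minimizer such that $\mathcal P_{s,\sigma,\pi}(\mathrm{Reach}(T))\not\rhd c$ for all strategies $\sigma$ of the maximizer. -/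

import Mathlib

open MeasureTheory ProbabilityTheory
open scoped NNReal ENNReal

/-- Who decides at a state: the maximizer, the minimizer, or chance. -/
inductive StateKind where
  | maximizer
  | minimizer
  | random

/-- A turn-based stochastic game (2½-player game) with state space `S`. -/
structure StochasticGame (S : Type*) where
  /-- the partition of the states -/
  kind : S → StateKind
  /-- the transition relation -/
  step : S → S → Prop
  /-- every state has a successor -/
  exists_step : ∀ s, ∃ s', step s s'
  /-- the probability function, defined on random states -/
  prob : {s : S // kind s = .random} → PMF S
  /-- `prob s` is a distribution over the successors of `s` -/
  step_of_mem_support : ∀ s, ∀ s' ∈ (prob s).support, step s.1 s'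

namespace StochasticGame

section Basic

variable {S : Type*} (G : StochasticGame S)

/-- Each state has only finitely many successors. -/
def FinitelyBranching : Prop := ∀ s, {s' | G.step s s'}.Finite

/-- A (history-dependent, randomized) strategy for the player who controls the states of kind `k`.
`choice w s` is the distribution chosen after the finite sequence `w s`, where `s` is the
current state and `w` lists the earlier states, oldest first. -/
structure Strategy (k : StateKind) where
  choice : List S → {s : S // G.kind s = k} → PMF S
  step_of_mem_support : ∀ w s, ∀ s' ∈ (choice w s).support, G.step s.1 s'

abbrev MaxStrategy := G.Strategy .maximizer

abbrev MinStrategy := G.Strategy .minimizer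

/-- Memoryless and deterministic: the choice is a Dirac distribution that depends only on the
current state. -/
def Strategy.IsMD {G : StochasticGame S} {k : StateKind} (τ : G.Strategy k) : Prop :=
  ∃ f : {s : S // G.kind s = k} → S, ∀ w s, τ.choice w s = PMF.pure (f s)

/-- The distribution of the next state after the finite sequence `w s`. -/
noncomputable def nextDist (σ : G.MaxStrategy) (π : G.MinStrategy) (w : List S) (s : S) : PMF S :=
  match h : G.kind s with
  | .maximizer => σ.choice w ⟨s, h⟩
  | .minimizer => π.choice w ⟨s, h⟩
  | .random => G.prob ⟨s, h⟩

/-- The states at times `0, …, n - 1` of a finite sequence indexed by `0, …, n`. -/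
def earlier {n : ℕ} (h : (i : Finset.Iic n) → S) : List S :=
  List.ofFn fun i : Fin n => h ⟨i, Finset.mem_Iic.2 i.2.le⟩

/-- The state at time `n` of a finite sequence indexed by `0, …, n`. -/
def current {n : ℕ} (h : (i : Finset.Iic n) → S) : S :=
  h ⟨n, Finset.mem_Iic.2 le_rfl⟩

end Basic

section Measure

variable {S : Type*} [Countable S] [MeasurableSpace S] [DiscreteMeasurableSpace S]
  (G : StochasticGame S)

/-- The law of the state at time `n + 1` given the states at times `0, …, n`. -/
noncomputable def stepKernel (σ : G.MaxStrategy) (π : G.MinStrategy) (n : ℕ) :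
    Kernel ((i : Finset.Iic n) → (fun _ : ℕ => S) i) ((fun _ : ℕ => S) (n + 1)) where
  toFun h := (G.nextDist σ π (earlier h) (current h)).toMeasure
  measurable' := Measurable.of_discrete

instance (σ : G.MaxStrategy) (π : G.MinStrategy) (n : ℕ) :
    IsMarkovKernel (G.stepKernel σ π n) :=
  ⟨fun h => PMF.toMeasure.isProbabilityMeasure (G.nextDist σ π (earlier h) (current h))⟩

/-- The probability measure on infinite sequences of states that is induced by the initial state
`s₀` and the two strategies (Ionescu-Tulcea). The σ-algebra is the product of the discrete ones,
that is, the one generated by the cylinder sets. -/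
noncomputable def playMeasure (s₀ : S) (σ : G.MaxStrategy) (π : G.MinStrategy) :
    Measure (ℕ → S) :=
  Kernel.traj (X := fun _ => S) (G.stepKernel σ π) 0 (fun _ => s₀)

/-- `v` is the value of `s` for the event `E`: sup inf and inf sup both equal `v`. -/
def HasValue (E : Set (ℕ → S)) (s : S) (v : ℝ≥0∞) : Prop :=
  (⨆ σ : G.MaxStrategy, ⨅ π : G.MinStrategy, G.playMeasure s σ π E) = v ∧
    (⨅ π : G.MinStrategy, ⨆ σ : G.MaxStrategy, G.playMeasure s σ π E) = v

/-- `s` and `s'` have values, and that of `s'` is smaller. -/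
def ValueDecreasing (E : Set (ℕ → S)) (s s' : S) : Prop :=
  ∃ v v', G.HasValue E s v ∧ G.HasValue E s' v' ∧ v' < v

/-- `s` and `s'` have values, and that of `s'` is larger. -/
def ValueIncreasing (E : Set (ℕ → S)) (s s' : S) : Prop :=
  ∃ v v', G.HasValue E s v ∧ G.HasValue E s' v' ∧ v < v'

/-- The event that the target set `T` is visited. -/
def reach (T : Set S) : Set (ℕ → S) := {w | ∃ i, w i ∈ T}

/-- The comparison in a threshold objective: `≥` or `>`. -/
inductive ThresholdRel where
  | ge
  | gt

/-- `r.Holds p c` says `p ≥ c` or `p > c`. -/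
def ThresholdRel.Holds : ThresholdRel → ℝ≥0∞ → ℝ≥0∞ → Prop
  | .ge, p, c => p ≥ c
  | .gt, p, c => p > c

/-- From every state, the maximizer has an MD strategy that wins the threshold objective
`(E, r c)`, or the minimizer has an MD strategy that wins its complement. -/
def StronglyMDDetermined (E : Set (ℕ → S)) (r : ThresholdRel) (c : ℝ≥0∞) : Prop :=
  ∀ s : S,
    (∃ σ : G.MaxStrategy, σ.IsMD ∧ ∀ π : G.MinStrategy, r.Holds (G.playMeasure s σ π E) c) ∨
    (∃ π : G.MinStrategy, π.IsMD ∧ ∀ σ : G.MaxStrategy, ¬ r.Holds (G.playMeasure s σ π E) c)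

end Measure

end StochasticGame

/-! By finite branching, the value is the limit of the values of the games with n steps
(`bellman_value`). A minimizer who always moves to a successor of least value keeps the reaching
probability at most the value. Discounting gives the maximizer MD strategies that exceed any bound
below the value. This settles `>` for every c, and `≥` whenever the value differs from c. What
remains is `≥` at states of value exactly c.

If the maximizer's moves never change the value, an MD strategy is optimal everywhere
(`exists_selector_value_le`). State by state, the moves on a finite set are fixed so that they alone
secure half of the value there, at no loss elsewhere. In the limit half of the value is secured
everywhere, and `le_value_of_mul_le` lifts this to the whole value. This is condition (1).

Under (2) on all states, and under (3) on the states of value 1, the minimizer's moves preserve the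
value. There, let L be built up transfinitely: a state enters when value-preserving moves that avoid
the earlier states no longer secure its value. Induction on the rank gives one MD minimizer strategy
that keeps the maximizer below the value on L. Off L, value-preserving moves secure the value, and
the argument for (1) makes them MD. -/

namespace StochasticGame

/-! ### Value iteration and the fixed-point equation. -/

section Bellman

variable {S : Type*} {G : StochasticGame S}

open Classical in
/-- The one-step reachability operator of the game in which the maximizer's moves at `x` are
restricted to `A x` and the states of `D \ T` are losing. -/
noncomputable def bellman (G : StochasticGame S) (A : S → Set S) (T D : Set S) (f : S → ℝ≥0∞)
    (x : S) : ℝ≥0∞ :=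
  if x ∈ T then 1 else if x ∈ D then 0 else
    match h : G.kind x with
    | .maximizer => ⨆ y ∈ A x, f y
    | .minimizer => ⨅ y ∈ {y | G.step x y}, f y
    | .random => ∑' y, G.prob ⟨x, h⟩ y * f y

/-- The value of the restricted game when `T` has to be visited before time `n`. -/
noncomputable def valueWithin (G : StochasticGame S) (A : S → Set S) (T D : Set S) :
    ℕ → S → ℝ≥0∞
  | 0 => 0
  | n + 1 => G.bellman A T D (valueWithin G A T D n)

/-- The value of the game in which the maximizer's moves at `x` are restricted to `A x` and the
states of `D \ T` are losing. -/
noncomputable def value (G : StochasticGame S) (A : S → Set S) (T D : Set S) (x : S) : ℝ≥0∞ :=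
  ⨆ n, G.valueWithin A T D n x

variable {A B : S → Set S} {T D E : Set S} {f g w : S → ℝ≥0∞} {x : S}

theorem bellman_target (hT : x ∈ T) : G.bellman A T D f x = 1 := by
  simp [bellman, hT]

theorem bellman_dead (hT : x ∉ T) (hD : x ∈ D) : G.bellman A T D f x = 0 := by
  simp [bellman, hT, hD]

theorem bellman_max (hT : x ∉ T) (hD : x ∉ D) (h : G.kind x = .maximizer) :
    G.bellman A T D f x = ⨆ y ∈ A x, f y := by
  rw [bellman, if_neg hT, if_neg hD]
  split <;> simp_all

theorem bellman_min (hT : x ∉ T) (hD : x ∉ D) (h : G.kind x = .minimizer) :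
    G.bellman A T D f x = ⨅ y ∈ {y | G.step x y}, f y := by
  rw [bellman, if_neg hT, if_neg hD]
  split <;> simp_all

theorem bellman_random (hT : x ∉ T) (hD : x ∉ D) (h : G.kind x = .random) :
    G.bellman A T D f x = ∑' y, G.prob ⟨x, h⟩ y * f y := by
  rw [bellman, if_neg hT, if_neg hD]
  split <;> simp_all

/-- Case distinction for the state to which the one-step operator is applied. -/
theorem bellman_cases (G : StochasticGame S) (T D : Set S) (x : S) :
    x ∈ T ∨ (x ∉ T ∧ x ∈ D) ∨ (x ∉ T ∧ x ∉ D ∧ G.kind x = .maximizer) ∨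
      (x ∉ T ∧ x ∉ D ∧ G.kind x = .minimizer) ∨ (x ∉ T ∧ x ∉ D ∧ G.kind x = .random) := by
  cases h : G.kind x <;> simp <;> tauto

theorem bellman_mono (h : ∀ x, f x ≤ g x) (x : S) :
    G.bellman A T D f x ≤ G.bellman A T D g x := by
  rcases bellman_cases G T D x with hT | ⟨hT, hD⟩ | ⟨hT, hD, hk⟩ | ⟨hT, hD, hk⟩ | ⟨hT, hD, hk⟩
  · simp [bellman_target hT]
  · simp [bellman_dead hT hD]
  · rw [bellman_max hT hD hk, bellman_max hT hD hk]
    exact iSup₂_mono fun y _ => h y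
  · rw [bellman_min hT hD hk, bellman_min hT hD hk]
    exact iInf₂_mono fun y _ => h y
  · rw [bellman_random hT hD hk, bellman_random hT hD hk]
    exact ENNReal.tsum_le_tsum fun y => mul_le_mul_right (h y) _

theorem bellman_mono_moves (hAB : ∀ x, A x ⊆ B x) (hED : E ⊆ D) (x : S) :
    G.bellman A T D f x ≤ G.bellman B T E f x := by
  rcases bellman_cases G T D x with hT | ⟨hT, hD⟩ | ⟨hT, hD, hk⟩ | ⟨hT, hD, hk⟩ | ⟨hT, hD, hk⟩
  · simp [bellman_target hT]
  · simp [bellman_dead hT hD]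
  · rw [bellman_max hT hD hk, bellman_max hT (fun h => hD (hED h)) hk]
    exact biSup_mono (hAB x)
  · rw [bellman_min hT hD hk, bellman_min hT (fun h => hD (hED h)) hk]
  · rw [bellman_random hT hD hk, bellman_random hT (fun h => hD (hED h)) hk]

theorem bellman_le_one (h : ∀ x, f x ≤ 1) (x : S) : G.bellman A T D f x ≤ 1 := by
  rcases bellman_cases G T D x with hT | ⟨hT, hD⟩ | ⟨hT, hD, hk⟩ | ⟨hT, hD, hk⟩ | ⟨hT, hD, hk⟩
  · simp [bellman_target hT]
  · simp [bellman_dead hT hD]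
  · rw [bellman_max hT hD hk]
    exact iSup₂_le fun y _ => h y
  · rw [bellman_min hT hD hk]
    obtain ⟨y, hy⟩ := G.exists_step x
    exact (iInf₂_le y hy).trans (h y)
  · rw [bellman_random hT hD hk]
    calc ∑' y, G.prob ⟨x, hk⟩ y * f y ≤ ∑' y, G.prob ⟨x, hk⟩ y * 1 :=
          ENNReal.tsum_le_tsum fun y => mul_le_mul_right (h y) _
      _ = 1 := by simp [PMF.tsum_coe]

theorem valueWithin_succ (n : ℕ) :
    G.valueWithin A T D (n + 1) = G.bellman A T D (G.valueWithin A T D n) := rfl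

theorem valueWithin_zero : G.valueWithin A T D 0 x = 0 := rfl

theorem valueWithin_le_succ (n : ℕ) (x : S) :
    G.valueWithin A T D n x ≤ G.valueWithin A T D (n + 1) x := by
  induction n generalizing x with
  | zero => exact zero_le
  | succ n ih => exact bellman_mono ih x

theorem valueWithin_monotone (x : S) : Monotone fun n => G.valueWithin A T D n x :=
  monotone_nat_of_le_succ fun n => valueWithin_le_succ n x

theorem valueWithin_le_one (n : ℕ) (x : S) : G.valueWithin A T D n x ≤ 1 := by
  induction n generalizing x with
  | zero => exact zero_le
  | succ n ih => exact bellman_le_one ih x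

theorem valueWithin_le_value (n : ℕ) (x : S) : G.valueWithin A T D n x ≤ G.value A T D x :=
  le_iSup (fun n => G.valueWithin A T D n x) n

theorem value_le_one (x : S) : G.value A T D x ≤ 1 :=
  iSup_le fun n => valueWithin_le_one n x

theorem value_ne_top (x : S) : G.value A T D x ≠ ∞ :=
  ((value_le_one x).trans_lt ENNReal.one_lt_top).ne

theorem valueWithin_mono_moves (hAB : ∀ x, A x ⊆ B x) (hED : E ⊆ D) (n : ℕ) (x : S) :
    G.valueWithin A T D n x ≤ G.valueWithin B T E n x := by
  induction n generalizing x with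
  | zero => exact zero_le
  | succ n ih => exact (bellman_mono ih x).trans (bellman_mono_moves hAB hED x)

theorem value_mono_moves (hAB : ∀ x, A x ⊆ B x) (hED : E ⊆ D) (x : S) :
    G.value A T D x ≤ G.value B T E x :=
  iSup_mono fun n => valueWithin_mono_moves hAB hED n x

theorem value_le_bellman (x : S) : G.value A T D x ≤ G.bellman A T D (G.value A T D) x :=
  iSup_le fun n => (valueWithin_le_succ n x).trans (bellman_mono (valueWithin_le_value n) x)

/-- Each of the finitely many sequences passes `t` at some index, and a common bound for these
indices serves them all. -/
theorem biInf_iSup_le_of_finite {s : Set S} (hs : s.Finite) {a : ℕ → S → ℝ≥0∞}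
    (ha : ∀ y, Monotone fun n => a n y) : ⨅ y ∈ s, ⨆ n, a n y ≤ ⨆ n, ⨅ y ∈ s, a n y := by
  refine le_of_forall_lt fun t ht => ?_
  have h1 : ∀ y ∈ s, ∃ n, t < a n y := fun y hy => lt_iSup_iff.1 (ht.trans_le (iInf₂_le y hy))
  choose! N hN using h1
  obtain ⟨M, hM⟩ := (hs.image N).bddAbove
  refine lt_iSup_iff.2 ⟨M, ?_⟩
  rcases s.eq_empty_or_nonempty with rfl | hne
  · simpa using ht.trans_le le_top
  obtain ⟨y, hy, h⟩ := Set.exists_min_image s (a M) hs hne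
  exact ((hN y hy).trans_le (ha y (hM ⟨y, hy, rfl⟩))).trans_le (le_iInf₂ h)

/-- Increasing limits commute with suprema and, by monotone convergence, with means. Only the
infimum at minimizer states needs finite branching. -/
theorem bellman_value (hG : G.FinitelyBranching) (x : S) :
    G.bellman A T D (G.value A T D) x = G.value A T D x := by
  refine le_antisymm ?_ (value_le_bellman x)
  have key : ∀ n, G.bellman A T D (G.valueWithin A T D n) x ≤ G.value A T D x :=
    fun n => valueWithin_le_value (n + 1) x
  rcases bellman_cases G T D x with hT | ⟨hT, hD⟩ | ⟨hT, hD, hk⟩ | ⟨hT, hD, hk⟩ | ⟨hT, hD, hk⟩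
  · simpa [bellman_target hT] using key 0
  · simp [bellman_dead hT hD]
  · rw [bellman_max hT hD hk]
    refine iSup₂_le fun y hy => iSup_le fun n => le_trans ?_ (key n)
    rw [bellman_max hT hD hk]
    exact le_iSup₂ (f := fun y _ => G.valueWithin A T D n y) y hy
  · rw [bellman_min hT hD hk]
    refine (biInf_iSup_le_of_finite (hG x) valueWithin_monotone).trans (iSup_le fun n => ?_)
    simpa only [bellman_min hT hD hk] using key n
  · rw [bellman_random hT hD hk]
    rw [ENNReal.tsum_eq_iSup_sum]
    refine iSup_le fun F => ?_
    simp only [value, ENNReal.mul_iSup]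
    rw [ENNReal.finsetSum_iSup_of_monotone
      fun y => (valueWithin_monotone y).const_mul (zero_le)]
    refine iSup_le fun n => le_trans ?_ (key n)
    rw [bellman_random hT hD hk]
    exact ENNReal.sum_le_tsum F

end Bellman

/-! ### Good and optimal positional choices of the maximizer. -/

section Selectors

variable {S : Type*} {G : StochasticGame S} {A B : S → Set S} {T D : Set S} {w : S → ℝ≥0∞}

theorem mul_bellman_le {c : ℝ≥0∞} (hc : c ≤ 1) (f : S → ℝ≥0∞) (x : S) :
    c * G.bellman A T D f x ≤ G.bellman A T D (fun y => c * f y) x := by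
  rcases bellman_cases G T D x with hT | ⟨hT, hD⟩ | ⟨hT, hD, hk⟩ | ⟨hT, hD, hk⟩ | ⟨hT, hD, hk⟩
  · simpa [bellman_target hT] using hc
  · simp [bellman_dead hT hD]
  · rw [bellman_max hT hD hk, bellman_max hT hD hk]
    simp only [ENNReal.mul_iSup, le_refl]
  · rw [bellman_min hT hD hk, bellman_min hT hD hk]
    exact le_iInf₂ fun y hy => mul_le_mul_right (iInf₂_le y hy) c
  · rw [bellman_random hT hD hk, bellman_random hT hD hk, ← ENNReal.tsum_mul_left]
    exact ENNReal.tsum_le_tsum fun y => (mul_left_comm _ _ _).le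

/-- If the maximizer's moves keep a subharmonic function `w` unchanged, then a value that is at
least a positive multiple of `w` is at least `w`. -/
theorem le_value_of_mul_le (hG : G.FinitelyBranching) (hw1 : ∀ x, w x ≤ 1)
    (hw : ∀ x, w x ≤ G.bellman B T D w x)
    (hA : ∀ x, G.kind x = .maximizer → ∀ y ∈ A x, w y = w x)
    {c : ℝ≥0∞} (hc0 : c ≠ 0) (hc1 : c ≤ 1) (h : ∀ x, c * w x ≤ G.value A T D x) (x : S) :
    w x ≤ G.value A T D x := by
  have hc : c + (1 - c) = 1 := add_tsub_cancel_of_le hc1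
  -- Stop after n steps: a play that has met `T` is worth 1 = c + (1 - c), any other still has c * w
  -- in hand, and the mean of w has not dropped.
  have key : ∀ n x, c * w x + (1 - c) * G.valueWithin A T D n x ≤ G.value A T D x := by
    intro n
    induction n with
    | zero => intro x; simpa [valueWithin_zero] using h x
    | succ n ih =>
      intro x
      have hx := h x
      have hwx := hw x
      rw [valueWithin_succ]
      rw [← bellman_value hG] at hx ⊢
      rcases bellman_cases G T D x with hT | ⟨hT, hD⟩ | ⟨hT, hD, hk⟩ | ⟨hT, hD, hk⟩ | ⟨hT, hD, hk⟩
      · rw [bellman_target hT, bellman_target hT]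
        calc c * w x + (1 - c) * 1 ≤ c * 1 + (1 - c) * 1 := by gcongr; exact hw1 x
          _ = 1 := by simp [hc]
      · simpa [bellman_dead hT hD] using hx
      · rw [bellman_max hT hD hk] at hx ⊢
        rw [bellman_max hT hD hk]
        rcases (A x).eq_empty_or_nonempty with he | hne
        · simpa [he] using hx
        simp only [ENNReal.mul_iSup]
        rw [ENNReal.add_biSup hne]
        refine iSup₂_mono fun y hy => ?_
        rw [← hA x hk y hy]
        exact ih y
      · rw [bellman_min hT hD hk] at hwx
        rw [bellman_min hT hD hk, bellman_min hT hD hk]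
        refine le_iInf₂ fun y hy => le_trans ?_ (ih y)
        gcongr
        · exact hwx.trans (iInf₂_le y hy)
        · exact iInf₂_le y hy
      · rw [bellman_random hT hD hk] at hwx
        rw [bellman_random hT hD hk, bellman_random hT hD hk]
        calc _ ≤ c * (∑' y, G.prob ⟨x, hk⟩ y * w y) +
              (1 - c) * ∑' y, G.prob ⟨x, hk⟩ y * G.valueWithin A T D n y := by gcongr
          _ = ∑' y, G.prob ⟨x, hk⟩ y * (c * w y + (1 - c) * G.valueWithin A T D n y) := by
            rw [← ENNReal.tsum_mul_left, ← ENNReal.tsum_mul_left, ← ENNReal.tsum_add]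
            exact tsum_congr fun y => by ring
          _ ≤ _ := ENNReal.tsum_le_tsum fun y => mul_le_mul_right (ih y) _
  -- The limit of `key` reads c * w + (1 - c) * v ≤ v for the value v; cancelling the finite term (1
  -- - c) * v leaves w ≤ v.
  have key2 : c * w x + (1 - c) * G.value A T D x ≤ c * G.value A T D x +
      (1 - c) * G.value A T D x := by
    rw [← add_mul, hc, one_mul]
    conv_lhs => rw [value]
    rw [ENNReal.mul_iSup, ENNReal.add_iSup]
    exact iSup_le fun n => key n x
  have hfin : (1 - c) * G.value A T D x ≠ ∞ :=
    ENNReal.mul_ne_top (ENNReal.sub_ne_top ENNReal.one_ne_top) (value_ne_top x)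
  exact (ENNReal.mul_le_mul_iff_right hc0 (hc1.trans_lt ENNReal.one_lt_top).ne).1
    ((ENNReal.add_le_add_iff_right hfin).1 key2)

/-- Off `F` the two games have the same moves, so a play of the `B`-game can be copied until it
meets `F`, where `h` supplies the fraction c. -/
theorem mul_value_le_of_eqOn_compl (hG : G.FinitelyBranching) {F : Set S}
    (hAB : ∀ x, x ∉ F → A x = B x) {c : ℝ≥0∞} (hc1 : c ≤ 1)
    (h : ∀ x ∈ F, c * G.value B T D x ≤ G.value A T D x) (x : S) :
    c * G.value B T D x ≤ G.value A T D x := by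
  have key : ∀ n x, c * G.valueWithin B T D n x ≤ G.value A T D x := by
    intro n
    induction n with
    | zero => simp [valueWithin_zero]
    | succ n ih =>
      intro x
      by_cases hx : x ∈ F
      · exact (mul_le_mul_right (valueWithin_le_value (n + 1) x) c).trans (h x hx)
      calc _ ≤ G.bellman B T D (fun y => c * G.valueWithin B T D n y) x := mul_bellman_le hc1 _ x
        _ ≤ G.bellman B T D (G.value A T D) x := bellman_mono ih x
        _ = G.bellman A T D (G.value A T D) x := by
          rcases bellman_cases G T D x with hT | ⟨hT, hD⟩ | ⟨hT, hD, hk⟩ | ⟨hT, hD, hk⟩ | ⟨hT, hD, hk⟩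
          · rw [bellman_target hT, bellman_target hT]
          · rw [bellman_dead hT hD, bellman_dead hT hD]
          · rw [bellman_max hT hD hk, bellman_max hT hD hk, hAB x hx]
          · rw [bellman_min hT hD hk, bellman_min hT hD hk]
          · rw [bellman_random hT hD hk, bellman_random hT hD hk]
        _ = _ := bellman_value hG x
  rw [value, ENNReal.mul_iSup]
  exact iSup_le fun n => key n x

/-- The moves in `A` that agree with the selector `f` on the set `F`. -/
def fixMoves (A : S → Set S) (F : Set S) (f : S → S) (x : S) : Set S :=
  {y ∈ A x | x ∈ F → y = f x}

theorem fixMoves_subset (A : S → Set S) (F : Set S) (f : S → S) (x : S) :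
    fixMoves A F f x ⊆ A x := fun _ hy => hy.1

/-- The value within `n` steps when the payoff is multiplied by `γ` in every step. -/
noncomputable def discountedWithin (G : StochasticGame S) (γ : ℝ≥0∞) (A : S → Set S)
    (T D : Set S) : ℕ → S → ℝ≥0∞
  | 0 => 0
  | n + 1 => fun x => γ * G.bellman A T D (discountedWithin G γ A T D n) x

theorem pow_mul_valueWithin_le {γ : ℝ≥0∞} (hγ : γ ≤ 1) (n : ℕ) (x : S) :
    γ ^ n * G.valueWithin A T D n x ≤ G.discountedWithin γ A T D n x := by
  induction n generalizing x with
  | zero => simp [valueWithin_zero]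
  | succ n ih =>
    rw [pow_succ', mul_assoc]
    refine mul_le_mul_right ?_ γ
    exact (mul_bellman_le (pow_le_one' hγ n) _ x).trans (bellman_mono ih x)

theorem discountedWithin_le_one {γ : ℝ≥0∞} (hγ : γ ≤ 1) (n : ℕ) (x : S) :
    G.discountedWithin γ A T D n x ≤ 1 := by
  induction n generalizing x with
  | zero => exact zero_le
  | succ n ih => exact mul_le_one' hγ (bellman_le_one ih x)

/-- A single selector attains at least the discounted value everywhere. -/
theorem exists_selector_discounted (hA : ∀ x, (A x).Finite) {γ : ℝ≥0∞}
    (hγ : γ < 1) : ∃ f : S → S, (∀ x, (A x).Nonempty → f x ∈ A x) ∧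
      ∀ n x, G.discountedWithin γ A T D n x ≤ G.value (fixMoves A Set.univ f) T D x := by
  set g : S → ℝ≥0∞ := fun x => ⨆ n, G.discountedWithin γ A T D n x with hg
  have hg1 : ∀ x, g x ≤ 1 := fun x => iSup_le fun n => discountedWithin_le_one hγ.le n x
  have hgb : ∀ x, g x ≤ γ * G.bellman A T D g x := by
    refine fun x => iSup_le fun n => ?_
    cases n with
    | zero => exact zero_le
    | succ n =>
      exact mul_le_mul_right
        (bellman_mono (fun y => le_iSup (fun n => G.discountedWithin γ A T D n y) n) x) γ
  -- The selector is greedy for the discounted value. For the undiscounted value a greedy choice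
  -- could postpone the visit to `T` forever.
  have hsel : ∀ x, ∃ y, ((A x).Nonempty → y ∈ A x) ∧ ∀ z ∈ A x, g z ≤ g y := by
    intro x
    rcases (A x).eq_empty_or_nonempty with he | hne
    · exact ⟨x, by simp [he]⟩
    · obtain ⟨y, hy, h⟩ := Set.exists_max_image (A x) g (hA x) hne
      exact ⟨y, fun _ => hy, h⟩
  choose f hf1 hf2 using hsel
  refine ⟨f, hf1, ?_⟩
  -- Whatever is earned after n steps is discounted to at most γ ^ n, so following the greedy
  -- selector for n steps loses no more than that.
  have key : ∀ n x, g x ≤ G.valueWithin (fixMoves A Set.univ f) T D n x + γ ^ n := by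
    intro n
    induction n with
    | zero => simpa [valueWithin_zero] using hg1
    | succ n ih =>
      intro x
      refine (hgb x).trans ?_
      have hstep : ∀ y, γ * g y ≤ G.valueWithin (fixMoves A Set.univ f) T D n y + γ ^ (n + 1) := by
        intro y
        calc γ * g y ≤ γ * (G.valueWithin (fixMoves A Set.univ f) T D n y + γ ^ n) :=
              mul_le_mul_right (ih y) γ
          _ ≤ _ := by
            rw [mul_add, ← pow_succ']
            gcongr
            exact mul_le_of_le_one_left' hγ.le
      rw [valueWithin_succ]
      rcases bellman_cases G T D x with hT | ⟨hT, hD⟩ | ⟨hT, hD, hk⟩ | ⟨hT, hD, hk⟩ | ⟨hT, hD, hk⟩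
      · rw [bellman_target hT, bellman_target hT, mul_one]
        exact hγ.le.trans le_self_add
      · simp [bellman_dead hT hD]
      · rw [bellman_max hT hD hk, bellman_max hT hD hk]
        simp only [ENNReal.mul_iSup]
        refine iSup₂_le fun y hy => ?_
        calc γ * g y ≤ γ * g (f x) := mul_le_mul_right (hf2 x y hy) γ
          _ ≤ _ := hstep _
          _ ≤ _ := by
            gcongr
            exact le_iSup₂ (f := fun z _ => G.valueWithin (fixMoves A Set.univ f) T D n z) (f x)
              ⟨hf1 x ⟨y, hy⟩, fun _ => rfl⟩
      · rw [bellman_min hT hD hk, bellman_min hT hD hk]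
        simp only [iInf_subtype', ENNReal.iInf_add]
        exact le_iInf fun y => (mul_le_mul_right (iInf_le _ y) γ).trans (hstep y)
      · rw [bellman_random hT hD hk, bellman_random hT hD hk]
        calc γ * ∑' y, G.prob ⟨x, hk⟩ y * g y = ∑' y, G.prob ⟨x, hk⟩ y * (γ * g y) := by
              rw [← ENNReal.tsum_mul_left]; exact tsum_congr fun y => mul_left_comm _ _ _
          _ ≤ ∑' y, G.prob ⟨x, hk⟩ y *
              (G.valueWithin (fixMoves A Set.univ f) T D n y + γ ^ (n + 1)) :=
            ENNReal.tsum_le_tsum fun y => mul_le_mul_right (hstep y) _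
          _ = _ := by
            simp only [mul_add]
            rw [ENNReal.tsum_add, ENNReal.tsum_mul_right, PMF.tsum_coe, one_mul]
  intro n x
  refine (le_iSup (fun n => G.discountedWithin γ A T D n x) n).trans ?_
  refine ge_of_tendsto' (f := fun m : ℕ => G.value (fixMoves A Set.univ f) T D x + γ ^ m)
    (x := Filter.atTop) ?_ fun m => (key m x).trans (by gcongr; exact valueWithin_le_value m x)
  simpa using (ENNReal.tendsto_pow_atTop_nhds_zero_of_lt_one hγ).const_add
    (G.value (fixMoves A Set.univ f) T D x)

/-- The maximizer has positional strategies that are arbitrarily good at a given state and have a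
positive value wherever this is possible. -/
theorem exists_selector_lt_value (hA : ∀ x, (A x).Finite) {s : S} {t : ℝ≥0∞}
    (ht : t < G.value A T D s) : ∃ f : S → S, (∀ x, (A x).Nonempty → f x ∈ A x) ∧
      t < G.value (fixMoves A Set.univ f) T D s ∧
      ∀ x, 0 < G.value A T D x → 0 < G.value (fixMoves A Set.univ f) T D x := by
  obtain ⟨n, hn⟩ := lt_iSup_iff.1 ht
  -- A discount close to 1 hardly changes the value within n steps at `s`; its being positive keeps
  -- every positive value positive.
  obtain ⟨γ, hγ1, hγ0, hγ⟩ : ∃ γ : ℝ≥0∞, γ < 1 ∧ 0 < γ ∧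
      t < γ ^ n * G.valueWithin A T D n s := by
    have hcont : Filter.Tendsto (fun γ : ℝ≥0∞ => γ ^ n * G.valueWithin A T D n s)
        (nhdsWithin 1 (Set.Iio 1)) (nhds (1 ^ n * G.valueWithin A T D n s)) := by
      refine Filter.Tendsto.mono_left ?_ nhdsWithin_le_nhds
      refine ENNReal.Tendsto.mul_const ?_ (Or.inl (by simp))
      exact (ENNReal.continuous_pow n).tendsto 1
    have h1 := hcont.eventually_const_lt (by simpa using hn)
    have h2 : ∀ᶠ γ : ℝ≥0∞ in nhdsWithin 1 (Set.Iio 1), 0 < γ :=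
      nhdsWithin_le_nhds (lt_mem_nhds one_pos)
    have : (nhdsWithin (1 : ℝ≥0∞) (Set.Iio 1)).NeBot := nhdsLT_neBot_of_exists_lt ⟨0, one_pos⟩
    obtain ⟨γ, ⟨h1, h2⟩, h3⟩ := ((h1.and h2).and self_mem_nhdsWithin).exists
    exact ⟨γ, h3, h2, h1⟩
  obtain ⟨f, hf1, hf2⟩ := exists_selector_discounted (G := G) (T := T) (D := D) hA hγ1
  refine ⟨f, hf1, hγ.trans_le ((pow_mul_valueWithin_le hγ1.le n s).trans (hf2 n s)), ?_⟩
  intro x hx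
  obtain ⟨m, hm⟩ := lt_iSup_iff.1 hx
  refine lt_of_lt_of_le ?_ ((pow_mul_valueWithin_le hγ1.le m x).trans (hf2 m x))
  exact ENNReal.mul_pos (ENNReal.pow_pos hγ0 m).ne' hm.ne'

/-- The value within `n` steps depends on the maximizer's moves at finitely many states only. -/
theorem exists_finite_valueWithin_congr (hG : G.FinitelyBranching) (T D : Set S) (n : ℕ) (s : S) :
    ∃ F : Set S, F.Finite ∧ s ∈ F ∧ ∀ A B : S → Set S, (∀ x, A x ⊆ {y | G.step x y}) →
      (∀ x ∈ F, A x = B x) → G.valueWithin A T D n s = G.valueWithin B T D n s := by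
  induction n generalizing s with
  | zero => exact ⟨{s}, Set.finite_singleton s, rfl, fun _ _ _ _ => rfl⟩
  | succ n ih =>
    choose F hF hsF h using ih
    refine ⟨{s} ∪ ⋃ y ∈ {y | G.step s y}, F y,
      (Set.finite_singleton s).union ((hG s).biUnion fun y _ => hF y), Or.inl rfl, ?_⟩
    intro A B hA hAB
    have hy : ∀ y, G.step s y → G.valueWithin A T D n y = G.valueWithin B T D n y :=
      fun y hy => h y A B hA fun x hx => hAB x (Or.inr (Set.mem_biUnion hy hx))
    have hs : A s = B s := hAB s (Or.inl rfl)
    rw [valueWithin_succ, valueWithin_succ]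
    rcases bellman_cases G T D s with hT | ⟨hT, hD⟩ | ⟨hT, hD, hk⟩ | ⟨hT, hD, hk⟩ | ⟨hT, hD, hk⟩
    · rw [bellman_target hT, bellman_target hT]
    · rw [bellman_dead hT hD, bellman_dead hT hD]
    · rw [bellman_max hT hD hk, bellman_max hT hD hk, ← hs]
      exact iSup_congr fun y => iSup_congr fun h => hy y (hA s h)
    · rw [bellman_min hT hD hk, bellman_min hT hD hk]
      exact iInf_congr fun y => iInf_congr fun h => hy y h
    · rw [bellman_random hT hD hk, bellman_random hT hD hk]
      refine tsum_congr fun y => ?_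
      by_cases hp : G.prob ⟨s, hk⟩ y = 0
      · simp [hp]
      · rw [hy y (G.step_of_mem_support ⟨s, hk⟩ y ((PMF.mem_support_iff _ _).2 hp))]

/-- On a finite set, pointwise positivity gives one common constant: the least of the relevant
values of `u`, capped at 1. -/
theorem exists_pos_mul_le_of_finite {F : Set S} (hF : F.Finite) {u : S → ℝ≥0∞}
    (hw1 : ∀ x, w x ≤ 1) (h : ∀ x ∈ F, 0 < w x → 0 < u x) :
    ∃ c : ℝ≥0∞, c ≠ 0 ∧ c ≤ 1 ∧ ∀ x ∈ F, c * w x ≤ u x := by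
  induction F, hF using Set.Finite.induction_on with
  | empty => exact ⟨1, by simp⟩
  | @insert a F ha hF ih =>
    obtain ⟨c, hc0, hc1, hc⟩ := ih fun x hx => h x (Or.inr hx)
    rcases eq_or_ne (w a) 0 with h0 | h0
    · refine ⟨c, hc0, hc1, ?_⟩
      rintro x (rfl | hx)
      · simp [h0]
      · exact hc x hx
    · refine ⟨min c (u a), ?_, (min_le_left _ _).trans hc1, ?_⟩
      · exact (lt_min (pos_iff_ne_zero.2 hc0) (h a (Or.inl rfl) (pos_iff_ne_zero.2 h0))).ne'
      · rintro x (rfl | hx)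
        · exact (mul_le_of_le_one_right' (hw1 x)).trans (min_le_right _ _)
        · exact (mul_le_mul_left (min_le_left _ _) _).trans (hc x hx)

/-- The maximizer's moves can be fixed on a finite set, without loss of value, so that these
moves alone guarantee half of the value at `s`. -/
theorem exists_fixMoves (hG : G.FinitelyBranching) (hA : ∀ x, A x ⊆ {y | G.step x y})
    (hAw : ∀ x, G.kind x = .maximizer → ∀ y ∈ A x, G.value A T D y = G.value A T D x) (s : S) :
    ∃ A' : S → Set S, (∀ x, A' x ⊆ A x) ∧ (∀ x, (A x).Nonempty → (A' x).Nonempty) ∧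
      (∀ x, G.value A' T D x = G.value A T D x) ∧ ∃ F : Set S, s ∈ F ∧
      (∀ x ∈ F, (A' x).Subsingleton) ∧
      ∀ B : S → Set S, (∀ x ∈ F, A' x = B x) → 2⁻¹ * G.value A T D s ≤ G.value B T D s := by
  obtain ⟨f, hfA, hfs, hf⟩ : ∃ f : S → S, (∀ x, (A x).Nonempty → f x ∈ A x) ∧
      (∃ n, 2⁻¹ * G.value A T D s ≤ G.valueWithin (fixMoves A Set.univ f) T D n s) ∧
      ∀ x, 0 < G.value A T D x → 0 < G.value (fixMoves A Set.univ f) T D x := by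
    have hfin : ∀ x, (A x).Finite := fun x => (hG x).subset (hA x)
    rcases eq_or_ne (G.value A T D s) 0 with h0 | h0
    -- Half of the value at `s` is now nothing, but positivity elsewhere is still needed; any `z` of
    -- positive value yields such a selector.
    · by_cases hex : ∃ z, 0 < G.value A T D z
      · obtain ⟨z, hz⟩ := hex
        obtain ⟨f, h1, h2, h3⟩ := exists_selector_lt_value hfin hz
        exact ⟨f, h1, ⟨0, by simp [h0]⟩, h3⟩
      · have hsel : ∀ x, ∃ y, (A x).Nonempty → y ∈ A x := fun x => by
          by_cases hx : (A x).Nonempty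
          · exact ⟨hx.some, fun _ => hx.some_mem⟩
          · exact ⟨x, fun h => absurd h hx⟩
        choose f hf using hsel
        exact ⟨f, hf, ⟨0, by simp [h0]⟩, fun x hx => absurd ⟨x, hx⟩ hex⟩
    · have hlt : 2⁻¹ * G.value A T D s < G.value A T D s := by
        rw [mul_comm, ← div_eq_mul_inv]
        exact ENNReal.half_lt_self h0 (value_ne_top s)
      obtain ⟨f, h1, h2, h3⟩ := exists_selector_lt_value hfin hlt
      obtain ⟨n, hn⟩ := lt_iSup_iff.1 h2
      exact ⟨f, h1, ⟨n, hn.le⟩, h3⟩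
  obtain ⟨n, hn⟩ := hfs
  obtain ⟨F, hF, hsF, hcongr⟩ := exists_finite_valueWithin_congr hG T D n s
  have hsub : ∀ x, fixMoves A F f x ⊆ A x := fixMoves_subset A F f
  have hle : ∀ x, G.value (fixMoves A Set.univ f) T D x ≤ G.value (fixMoves A F f) T D x :=
    value_mono_moves (fun x y hy => ⟨hy.1, fun _ => hy.2 trivial⟩) subset_rfl
  -- Fixing `f` on `F` keeps positive values positive, hence at least c times the old ones on the
  -- finite set `F`. The bound spreads to all states and is then lifted to equality.
  obtain ⟨c, hc0, hc1, hc⟩ := exists_pos_mul_le_of_finite hF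
    (u := G.value (fixMoves A F f) T D) value_le_one fun x _ hx => (hf x hx).trans_le (hle x)
  refine ⟨fixMoves A F f, hsub, fun x hx => ⟨f x, hfA x hx, fun _ => rfl⟩, fun x => ?_, F, hsF,
    fun x hx y hy z hz => (hy.2 hx).trans (hz.2 hx).symm, fun B hB => ?_⟩
  · refine le_antisymm (value_mono_moves hsub subset_rfl x) ?_
    refine le_value_of_mul_le (B := A) hG value_le_one value_le_bellman
      (fun x hk y hy => hAw x hk y (hsub x hy)) hc0 hc1 ?_ x
    refine mul_value_le_of_eqOn_compl hG (F := F) (fun x hx => ?_) hc1 hc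
    exact Set.Subset.antisymm (hsub x) fun y hy => ⟨hy, fun h => absurd h hx⟩
  -- Within n steps only the moves on `F` matter, and there `B` follows `f`.
  · refine hn.trans (le_trans (le_of_eq ?_) (valueWithin_le_value n s))
    refine hcongr _ _ (fun x => (fixMoves_subset _ _ _ x).trans (hA x)) fun x hx => ?_
    rw [← hB x hx]
    ext y
    simp [fixMoves, hx]

/-- If the moves of the maximizer do not change the value, then the maximizer has a positional
strategy that is optimal everywhere. -/
theorem exists_selector_value_le [Countable S] (hG : G.FinitelyBranching)
    (hA : ∀ x, A x ⊆ {y | G.step x y})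
    (hAw : ∀ x, G.kind x = .maximizer → ∀ y ∈ A x, G.value A T D y = G.value A T D x) :
    ∃ f : S → S, ∀ x, G.value A T D x ≤ G.value (fixMoves A Set.univ f) T D x := by
  rcases isEmpty_or_nonempty S with hS | hS
  · exact ⟨id, fun x => isEmptyElim x⟩
  obtain ⟨e, he⟩ := exists_surjective_nat S
  let P := {A' : S → Set S // (∀ x, A' x ⊆ A x) ∧ ∀ x, G.value A' T D x = G.value A T D x}
  have hstage : ∀ (p : P) (s : S), ∃ q : P, (∀ x, q.1 x ⊆ p.1 x) ∧
      (∀ x, (p.1 x).Nonempty → (q.1 x).Nonempty) ∧ ∃ F : Set S, s ∈ F ∧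
      (∀ x ∈ F, (q.1 x).Subsingleton) ∧
      ∀ B : S → Set S, (∀ x ∈ F, q.1 x = B x) → 2⁻¹ * G.value A T D s ≤ G.value B T D s := by
    rintro ⟨p, hp1, hp2⟩ s
    obtain ⟨q, h1, h2, h3, F, h4, h5, h6⟩ := exists_fixMoves (T := T) (D := D) hG
      (fun x => (hp1 x).trans (hA x))
      (fun x hk y hy => by rw [hp2, hp2]; exact hAw x hk y (hp1 x hy)) s
    exact ⟨⟨q, fun x => (h1 x).trans (hp1 x), fun x => (h3 x).trans (hp2 x)⟩, h1, h2, F, h4, h5,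
      fun B hB => by rw [← hp2 s]; exact h6 B hB⟩
  choose next hsub hne F hF hsing hval using hstage
  let M : ℕ → P := fun n => Nat.rec ⟨A, fun _ => subset_rfl, fun _ => rfl⟩
    (fun n p => next p (e n)) n
  have hM : ∀ n, M (n + 1) = next (M n) (e n) := fun n => rfl
  have hanti : ∀ x, Antitone fun n => (M n).1 x :=
    fun x => antitone_nat_of_succ_le fun n => hsub (M n) (e n) x
  -- Move sets on a treated `F` have at most one element and nonempty ones never become empty, so
  -- later stages leave them unchanged.
  have hconst : ∀ n, ∀ x ∈ F (M n) (e n), ∀ k, (M (n + 1 + k)).1 x = (M (n + 1)).1 x := by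
    intro n x hx k
    refine Set.Subset.antisymm (hanti x (Nat.le_add_right _ _)) ?_
    induction k with
    | zero => exact subset_rfl
    | succ k ih =>
      intro y hy
      obtain ⟨z, hz⟩ := hne (M (n + 1 + k)) (e (n + 1 + k)) x ⟨y, ih hy⟩
      have hz' : z ∈ (M (n + 1)).1 x := hanti x (Nat.le_add_right _ (k + 1)) hz
      rw [hsing (M n) (e n) x hx hy hz']
      exact hz
  have hlim : ∀ n, ∀ x ∈ F (M n) (e n), (M (n + 1)).1 x = ⋂ m, (M m).1 x := by
    intro n x hx
    refine Set.Subset.antisymm (Set.subset_iInter fun m => ?_)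
      (Set.iInter_subset (fun m => (M m).1 x) (n + 1))
    rcases le_total m (n + 1) with h | h
    · exact hanti x h
    · obtain ⟨k, rfl⟩ := Nat.exists_eq_add_of_le h
      exact (hconst n x hx k).ge
  -- The limit game inherits the fixed moves of every stage, hence half of the value at every state;
  -- `le_value_of_mul_le` removes the factor.
  have hbest : ∀ x, G.value A T D x ≤ G.value (fun x => ⋂ m, (M m).1 x) T D x := by
    refine le_value_of_mul_le (B := A) (c := 2⁻¹) hG value_le_one value_le_bellman
      (fun x hk y hy => hAw x hk y (Set.mem_iInter.1 hy 0)) (by simp) (by simp) fun x => ?_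
    obtain ⟨n, rfl⟩ := he x
    exact hval (M n) (e n) _ (hlim n)
  have hsel : ∀ x, ∃ y, ∀ z ∈ ⋂ m, (M m).1 x, z = y := by
    intro x
    obtain ⟨n, rfl⟩ := he x
    rcases (⋂ m, (M m).1 (e n)).eq_empty_or_nonempty with h | ⟨y, hy⟩
    · exact ⟨e n, by simp [h]⟩
    · have hs := hsing (M n) (e n) (e n) (hF _ _)
      rw [← hM, hlim n _ (hF _ _)] at hs
      exact ⟨y, fun z hz => hs hz hy⟩
  choose f hf using hsel
  have hfix : ∀ x, (⋂ m, (M m).1 x) ⊆ fixMoves A Set.univ f x :=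
    fun x y hy => ⟨Set.mem_iInter.1 hy 0, fun _ => hf x y hy⟩
  exact ⟨f, fun x => (hbest x).trans (value_mono_moves hfix subset_rfl x)⟩

end Selectors

/-! ### From the path measure to recursive hitting probabilities. -/

section Hitting

variable {S : Type*} {G : StochasticGame S} {T : Set S} {σ : G.MaxStrategy} {π : G.MinStrategy}

open Classical in
/-- The probability that `T` is visited before `n` more states have been seen, when the play has
passed through `w` and is now in the given state. -/
noncomputable def hitWithin (G : StochasticGame S) (T : Set S) (σ : G.MaxStrategy)
    (π : G.MinStrategy) : ℕ → List S → S → ℝ≥0∞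
  | 0, _, _ => 0
  | n + 1, w, s =>
    if s ∈ T then 1 else ∑' y, G.nextDist σ π w s y * hitWithin G T σ π n (w ++ [s]) y

theorem hitWithin_succ_of_mem {n : ℕ} {w : List S} {s : S} (hs : s ∈ T) :
    G.hitWithin T σ π (n + 1) w s = 1 := by
  simp [hitWithin, hs]

theorem hitWithin_succ_of_notMem {n : ℕ} {w : List S} {s : S} (hs : s ∉ T) :
    G.hitWithin T σ π (n + 1) w s =
      ∑' y, G.nextDist σ π w s y * G.hitWithin T σ π n (w ++ [s]) y := by
  simp [hitWithin, hs]

theorem tsum_nextDist_mul_const (w : List S) (s : S) (a : ℝ≥0∞) :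
    ∑' y, G.nextDist σ π w s y * a = a := by
  rw [ENNReal.tsum_mul_right, PMF.tsum_coe, one_mul]

open Classical in
/-- The conditional probability, given the states at times `0, …, k`, of visiting `T` before
time `k + n`. -/
noncomputable def hitGiven (G : StochasticGame S) (T : Set S) (σ : G.MaxStrategy)
    (π : G.MinStrategy) (n k : ℕ) (h : (i : Finset.Iic k) → S) : ℝ≥0∞ :=
  if ∃ i : Finset.Iic k, i.1 < k ∧ h i ∈ T then 1 else G.hitWithin T σ π n (earlier h) (current h)

/-- One step of the tower property, with `z y` the history `h` prolonged by `y`. The cases are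
whether `T` was met before time k, is met at k, or neither. -/
theorem tsum_nextDist_mul_hitGiven (n k : ℕ) (h : (i : Finset.Iic k) → S)
    (z : S → (i : Finset.Iic (k + 1)) → S)
    (hz : ∀ y i (hi : i ≤ k), z y ⟨i, Finset.mem_Iic.2 (hi.trans k.le_succ)⟩ =
      h ⟨i, Finset.mem_Iic.2 hi⟩)
    (hzk : ∀ y, current (z y) = y) :
    ∑' y, G.nextDist σ π (earlier h) (current h) y * G.hitGiven T σ π n (k + 1) (z y) =
      G.hitGiven T σ π (n + 1) k h := by
  have hearlier : ∀ y, earlier (z y) = earlier h ++ [current h] := by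
    intro y
    rw [earlier, List.ofFn_succ', List.concat_eq_append]
    congr 2
    · exact funext fun i => hz y i i.2.le
    · exact hz y k le_rfl
  by_cases hex : ∃ i : Finset.Iic k, i.1 < k ∧ h i ∈ T
  · have hz1 : ∀ y, G.hitGiven T σ π n (k + 1) (z y) = 1 := by
      intro y
      obtain ⟨⟨i, hi⟩, hik, hiT⟩ := hex
      refine if_pos ⟨⟨i, Finset.mem_Iic.2 (hik.le.trans k.le_succ)⟩, hik.trans k.lt_succ_self, ?_⟩
      rw [hz y i hik.le]
      exact hiT
    simp only [hz1, tsum_nextDist_mul_const]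
    rw [hitGiven, if_pos hex]
  by_cases hc : current h ∈ T
  · have hz1 : ∀ y, G.hitGiven T σ π n (k + 1) (z y) = 1 := by
      intro y
      refine if_pos ⟨⟨k, Finset.mem_Iic.2 k.le_succ⟩, k.lt_succ_self, ?_⟩
      rw [hz y k le_rfl]
      exact hc
    simp only [hz1, tsum_nextDist_mul_const]
    rw [hitGiven, if_neg hex, hitWithin_succ_of_mem hc]
  · have hz1 : ∀ y, G.hitGiven T σ π n (k + 1) (z y) =
        G.hitWithin T σ π n (earlier h ++ [current h]) y := by
      intro y
      rw [hitGiven, if_neg, hearlier, hzk]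
      rintro ⟨⟨i, hi⟩, hik, hiT⟩
      have hik' : i ≤ k := Nat.lt_succ_iff.1 hik
      rw [hz y i hik'] at hiT
      rcases hik'.lt_or_eq with h1 | rfl
      · exact hex ⟨⟨i, Finset.mem_Iic.2 hik'⟩, h1, hiT⟩
      · exact hc hiT
    simp only [hz1]
    rw [hitGiven, if_neg hex, hitWithin_succ_of_notMem hc]

variable [Countable S] [MeasurableSpace S] [DiscreteMeasurableSpace S]

theorem lintegral_pmf_toMeasure (p : PMF S) (f : S → ℝ≥0∞) :
    ∫⁻ y, f y ∂p.toMeasure = ∑' y, p y * f y := by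
  rw [lintegral_countable']
  refine tsum_congr fun y => ?_
  rw [PMF.toMeasure_apply_singleton _ _ (MeasurableSet.of_discrete), mul_comm]

theorem lintegral_partialTraj_hitGiven (n k : ℕ) (h : (i : Finset.Iic k) → S) :
    ∫⁻ z, G.hitGiven T σ π n (k + 1) z
        ∂(Kernel.partialTraj (X := fun _ => S) (G.stepKernel σ π) k (k + 1) h) =
      G.hitGiven T σ π (n + 1) k h := by
  rw [Kernel.partialTraj_succ_self, Kernel.lintegral_map _ (by fun_prop) _ Measurable.of_discrete,
    Kernel.lintegral_id_prod (Measurable.of_discrete),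
    Kernel.lintegral_map _ (by fun_prop) _ Measurable.of_discrete]
  refine (lintegral_pmf_toMeasure _ _).trans ?_
  refine tsum_nextDist_mul_hitGiven n k h _ (fun y i hi => ?_) (fun y => ?_)
  · simp [IicProdIoc, hi]
  · simp [IicProdIoc, current, MeasurableEquiv.piSingleton]

theorem lintegral_hitGiven_succ (s : S) (n k : ℕ) :
    ∫⁻ ω, G.hitGiven T σ π n (k + 1) (Preorder.frestrictLe (k + 1) ω) ∂(G.playMeasure s σ π) =
      ∫⁻ ω, G.hitGiven T σ π (n + 1) k (Preorder.frestrictLe k ω) ∂(G.playMeasure s σ π) := by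
  have hmap : ∀ j, (G.playMeasure s σ π).map (Preorder.frestrictLe j) =
      Kernel.partialTraj (X := fun _ => S) (G.stepKernel σ π) 0 j (fun _ => s) := fun j =>
    Kernel.traj_map_frestrictLe_apply (X := fun _ => S) (κ := G.stepKernel σ π) 0 j (fun _ => s)
  have hint : ∀ j (f : ((i : Finset.Iic j) → S) → ℝ≥0∞),
      ∫⁻ ω, f (Preorder.frestrictLe j ω) ∂(G.playMeasure s σ π) =
      ∫⁻ z, f z ∂(Kernel.partialTraj (X := fun _ => S) (G.stepKernel σ π) 0 j (fun _ => s)) := by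
    intro j f
    rw [← hmap, lintegral_map Measurable.of_discrete (by fun_prop)]
  rw [hint, hint, Kernel.partialTraj_succ_eq_comp (Nat.zero_le k),
    Kernel.lintegral_comp _ _ _ Measurable.of_discrete]
  exact lintegral_congr fun h => lintegral_partialTraj_hitGiven n k h

/-- The mean of `hitGiven` is unchanged when known prefix and remaining horizon trade one step. With
horizon 0 it is the probability of the event, with prefix length 0 it is `hitWithin`. -/
theorem playMeasure_exists_lt (s : S) (n : ℕ) :
    G.playMeasure s σ π {ω | ∃ i < n, ω i ∈ T} = G.hitWithin T σ π n [] s := by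
  have hprob : IsProbabilityMeasure (G.playMeasure s σ π) := by
    rw [playMeasure]; infer_instance
  have hshift : ∀ k m,
      ∫⁻ ω, G.hitGiven T σ π m k (Preorder.frestrictLe k ω) ∂(G.playMeasure s σ π) =
      ∫⁻ ω, G.hitGiven T σ π (m + k) 0 (Preorder.frestrictLe 0 ω) ∂(G.playMeasure s σ π) := by
    intro k
    induction k with
    | zero => intro m; rfl
    | succ k ih => intro m; rw [lintegral_hitGiven_succ, ih, Nat.add_right_comm, Nat.add_assoc]
  have hmeas : MeasurableSet {ω : ℕ → S | ∃ i < n, ω i ∈ T} := by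
    have : {ω : ℕ → S | ∃ i < n, ω i ∈ T} = ⋃ i ∈ Set.Iio n, (fun ω => ω i) ⁻¹' T := by
      ext ω; simp
    rw [this]
    exact MeasurableSet.biUnion (Set.to_countable _) fun i _ =>
      measurable_pi_apply i MeasurableSet.of_discrete
  have h1 : G.playMeasure s σ π {ω | ∃ i < n, ω i ∈ T} =
      ∫⁻ ω, G.hitGiven T σ π 0 n (Preorder.frestrictLe n ω) ∂(G.playMeasure s σ π) := by
    rw [← lintegral_indicator_one hmeas]
    refine lintegral_congr fun ω => ?_
    have hiff : (∃ i : Finset.Iic n, i.1 < n ∧ Preorder.frestrictLe (π := fun _ => S) n ω i ∈ T) ↔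
        ∃ i < n, ω i ∈ T :=
      ⟨fun ⟨i, hi, h⟩ => ⟨i.1, hi, h⟩, fun ⟨i, hi, h⟩ => ⟨⟨i, Finset.mem_Iic.2 hi.le⟩, hi, h⟩⟩
    by_cases hω : ∃ i < n, ω i ∈ T
    · rw [hitGiven, if_pos (hiff.2 hω)]
      exact Set.indicator_of_mem hω 1
    · rw [hitGiven, if_neg (mt hiff.1 hω), hitWithin]
      exact Set.indicator_of_notMem hω 1
  rw [h1, hshift n 0, Nat.zero_add]
  have hmap : (G.playMeasure s σ π).map (Preorder.frestrictLe 0) = Measure.dirac fun _ => s := by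
    refine (Kernel.traj_map_frestrictLe_apply (X := fun _ => S) (κ := G.stepKernel σ π) 0 0
      (fun _ => s)).trans ?_
    rw [Kernel.partialTraj_self]
    rfl
  rw [← lintegral_map (f := G.hitGiven T σ π n 0) Measurable.of_discrete (by fun_prop), hmap,
    lintegral_dirac]
  simp [hitGiven, earlier, current]

/-- The probability of reaching `T` is the limit of the probabilities of reaching it in time. -/
theorem playMeasure_reach (s : S) :
    G.playMeasure s σ π (reach T) = ⨆ n, G.hitWithin T σ π n [] s := by
  have h : reach T = ⋃ n, {ω : ℕ → S | ∃ i < n, ω i ∈ T} := by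
    ext ω
    simp only [reach, Set.mem_ofPred_eq, Set.mem_iUnion]
    exact ⟨fun ⟨i, hi⟩ => ⟨i + 1, i, i.lt_succ_self, hi⟩, fun ⟨_, i, _, hi⟩ => ⟨i, hi⟩⟩
  have hmono : Monotone fun n => {ω : ℕ → S | ∃ i < n, ω i ∈ T} :=
    fun m n hmn ω ⟨i, hi, h⟩ => ⟨i, hi.trans_le hmn, h⟩
  rw [h, hmono.measure_iUnion]
  exact iSup_congr fun n => playMeasure_exists_lt s n

end Hitting

/-! ### MD strategies and their guarantees. -/

section Positional

variable {S : Type*} {G : StochasticGame S} {k : StateKind} {f : S → S} {T D : Set S}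
  {σ : G.MaxStrategy} {π : G.MinStrategy}

open Classical in
/-- The MD strategy that moves from `s` to `f s` whenever this is a transition. -/
noncomputable def positional (G : StochasticGame S) (k : StateKind) (f : S → S) :
    G.Strategy k where
  choice _ s := PMF.pure (if G.step s (f s) then f s else (G.exists_step s).choose)
  step_of_mem_support _ s s' h := by
    rw [PMF.mem_support_pure_iff] at h
    rw [h]
    split_ifs with hs
    · exact hs
    · exact (G.exists_step s).choose_spec

theorem positional_isMD : (G.positional k f).IsMD := ⟨_, fun _ _ => rfl⟩

theorem positional_choice {w : List S} {s : {s : S // G.kind s = k}} (h : G.step s (f s)) :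
    (G.positional k f).choice w s = PMF.pure (f s) := by
  simp [positional, h]

theorem nextDist_max {w : List S} {s : S} (h : G.kind s = .maximizer) :
    G.nextDist σ π w s = σ.choice w ⟨s, h⟩ := by
  unfold nextDist
  split <;> first | rfl | (rename_i h'; rw [h] at h'; cases h')

theorem nextDist_min {w : List S} {s : S} (h : G.kind s = .minimizer) :
    G.nextDist σ π w s = π.choice w ⟨s, h⟩ := by
  unfold nextDist
  split <;> first | rfl | (rename_i h'; rw [h] at h'; cases h')

theorem nextDist_random {w : List S} {s : S} (h : G.kind s = .random) :
    G.nextDist σ π w s = G.prob ⟨s, h⟩ := by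
  unfold nextDist
  split <;> first | rfl | (rename_i h'; rw [h] at h'; cases h')

theorem step_of_nextDist_ne_zero {w : List S} {s y : S} (h : G.nextDist σ π w s y ≠ 0) :
    G.step s y := by
  rw [← PMF.mem_support_iff] at h
  cases hk : G.kind s
  · rw [nextDist_max hk] at h; exact σ.step_of_mem_support w ⟨s, hk⟩ y h
  · rw [nextDist_min hk] at h; exact π.step_of_mem_support w ⟨s, hk⟩ y h
  · rw [nextDist_random hk] at h; exact G.step_of_mem_support ⟨s, hk⟩ y h

theorem tsum_pure_mul (a : S) (g : S → ℝ≥0∞) : ∑' y, PMF.pure a y * g y = g a := by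
  rw [tsum_eq_single a fun y hy => by simp [PMF.pure_apply, hy]]
  simp

theorem tsum_pmf_mul_le {p : PMF S} {g : S → ℝ≥0∞} {c : ℝ≥0∞} (h : ∀ y, p y ≠ 0 → g y ≤ c) :
    ∑' y, p y * g y ≤ c := by
  calc ∑' y, p y * g y ≤ ∑' y, p y * c := ENNReal.tsum_le_tsum fun y => by
        rcases eq_or_ne (p y) 0 with h0 | h0
        · simp [h0]
        · exact mul_le_mul_right (h y h0) _
    _ = c := by rw [ENNReal.tsum_mul_right, PMF.tsum_coe, one_mul]

theorem le_tsum_pmf_mul {p : PMF S} {g : S → ℝ≥0∞} {c : ℝ≥0∞} (h : ∀ y, p y ≠ 0 → c ≤ g y) :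
    c ≤ ∑' y, p y * g y := by
  calc c = ∑' y, p y * c := by rw [ENNReal.tsum_mul_right, PMF.tsum_coe, one_mul]
    _ ≤ ∑' y, p y * g y := ENNReal.tsum_le_tsum fun y => by
        rcases eq_or_ne (p y) 0 with h0 | h0
        · simp [h0]
        · exact mul_le_mul_right (h y h0) _

/-- Functions that are ordered pointwise and have the same finite mean agree on the support. -/
theorem eq_of_tsum_pmf_mul_le {p : PMF S} {g h : S → ℝ≥0∞} (hgh : ∀ y, p y ≠ 0 → g y ≤ h y)
    (hfin : ∑' y, p y * g y ≠ ∞) (hle : ∑' y, p y * h y ≤ ∑' y, p y * g y) {y : S}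
    (hy : p y ≠ 0) : g y = h y := by
  refine (hgh y hy).antisymm (not_lt.1 fun hlt => hle.not_gt ?_)
  refine ENNReal.tsum_lt_tsum (i := y) hfin (fun z => ?_) ?_
  · rcases eq_or_ne (p z) 0 with h0 | h0
    · simp [h0]
    · exact mul_le_mul_right (hgh z h0) _
  · exact ENNReal.mul_lt_mul_right hy (p.apply_ne_top y) hlt

/-- Real plays can only do better: dead states count as 0 on the left, and a randomized reply of the
minimizer is no smaller than the infimum. By `hA` every allowed move is one that `positional` really
makes. -/
theorem valueWithin_le_hitWithin {A : S → Set S} (hA : ∀ x, A x ⊆ {y | G.step x y})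
    (n : ℕ) (w : List S) (s : S) :
    G.valueWithin (fixMoves A Set.univ f) T D n s ≤
      G.hitWithin T (G.positional .maximizer f) π n w s := by
  induction n generalizing w s with
  | zero => exact zero_le
  | succ n ih =>
    rw [valueWithin_succ]
    rcases bellman_cases G T D s with hT | ⟨hT, hD⟩ | ⟨hT, hD, hk⟩ | ⟨hT, hD, hk⟩ | ⟨hT, hD, hk⟩
    · rw [bellman_target hT, hitWithin_succ_of_mem hT]
    · rw [bellman_dead hT hD]; exact zero_le
    · rw [bellman_max hT hD hk, hitWithin_succ_of_notMem hT, nextDist_max hk]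
      refine iSup₂_le fun y hy => ?_
      obtain rfl := hy.2 trivial
      rw [positional_choice (s := ⟨s, hk⟩) (hA s hy.1), tsum_pure_mul]
      exact ih _ _
    · rw [bellman_min hT hD hk, hitWithin_succ_of_notMem hT]
      exact le_tsum_pmf_mul fun y hy => (iInf₂_le y (step_of_nextDist_ne_zero hy)).trans (ih _ _)
    · rw [bellman_random hT hD hk, hitWithin_succ_of_notMem hT, nextDist_random hk]
      exact ENNReal.tsum_le_tsum fun y => mul_le_mul_right (ih _ _) _

/-- All transitions. -/
def successors (G : StochasticGame S) (x : S) : Set S := {y | G.step x y}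

/-- The value of the unrestricted reachability game. -/
noncomputable def reachValue (G : StochasticGame S) (T : Set S) : S → ℝ≥0∞ :=
  G.value G.successors T ∅

theorem reachValue_target (hG : G.FinitelyBranching) {x : S} (hT : x ∈ T) :
    G.reachValue T x = 1 := by
  rw [reachValue, ← bellman_value hG, bellman_target hT]

theorem reachValue_max (hG : G.FinitelyBranching) {x : S} (hT : x ∉ T)
    (h : G.kind x = .maximizer) : G.reachValue T x = ⨆ y ∈ G.successors x, G.reachValue T y := by
  conv_lhs => rw [reachValue, ← bellman_value hG, bellman_max hT (Set.notMem_empty x) h]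
  rfl

theorem reachValue_min (hG : G.FinitelyBranching) {x : S} (hT : x ∉ T)
    (h : G.kind x = .minimizer) : G.reachValue T x = ⨅ y ∈ G.successors x, G.reachValue T y := by
  conv_lhs => rw [reachValue, ← bellman_value hG, bellman_min hT (Set.notMem_empty x) h]
  rfl

theorem reachValue_random (hG : G.FinitelyBranching) {x : S} (hT : x ∉ T)
    (h : G.kind x = .random) :
    G.reachValue T x = ∑' y, G.prob ⟨x, h⟩ y * G.reachValue T y := by
  conv_lhs => rw [reachValue, ← bellman_value hG, bellman_random hT (Set.notMem_empty x) h]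
  rfl

theorem reachValue_le_of_step (hG : G.FinitelyBranching) {x y : S} (h : G.kind x = .maximizer)
    (hy : G.step x y) : G.reachValue T y ≤ G.reachValue T x := by
  by_cases hT : x ∈ T
  · rw [reachValue_target hG hT]; exact value_le_one y
  · rw [reachValue_max hG hT h]
    exact le_iSup₂ (f := fun y _ => G.reachValue T y) y hy

theorem le_reachValue_of_step (hG : G.FinitelyBranching) {x y : S} (hT : x ∉ T)
    (h : G.kind x = .minimizer) (hy : G.step x y) : G.reachValue T x ≤ G.reachValue T y := by
  rw [reachValue_min hG hT h]
  exact iInf₂_le y hy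

theorem exists_step_forall_le (hG : G.FinitelyBranching) (u : S → ℝ≥0∞) (x : S) :
    ∃ y, G.step x y ∧ ∀ z, G.step x z → u y ≤ u z :=
  Set.exists_min_image {y | G.step x y} u (hG x) (G.exists_step x)

/-- `f` describes moves of the minimizer that do not increase the value. -/
def IsValueOptimal (G : StochasticGame S) (T : Set S) (f : S → S) : Prop :=
  ∀ x, G.kind x = .minimizer → G.step x (f x) ∧ (x ∉ T → G.reachValue T (f x) ≤ G.reachValue T x)

theorem exists_isValueOptimal (hG : G.FinitelyBranching) (T : Set S) :
    ∃ f, G.IsValueOptimal T f := by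
  choose f hf1 hf2 using exists_step_forall_le hG (G.reachValue T)
  refine ⟨f, fun x hx => ⟨hf1 x, fun hT => ?_⟩⟩
  rw [reachValue_min hG hT hx]
  exact le_iInf₂ (hf2 x)

/-- Until `T` is met, the value along the play is a supermartingale: the maximizer cannot raise it,
`f` does not, and chance preserves its mean. -/
theorem tsum_nextDist_mul_reachValue_le (hG : G.FinitelyBranching) (hf : G.IsValueOptimal T f)
    (w : List S) {s : S} (hT : s ∉ T) :
    ∑' y, G.nextDist σ (G.positional .minimizer f) w s y * G.reachValue T y ≤
      G.reachValue T s := by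
  cases hk : G.kind s
  · exact tsum_pmf_mul_le fun y hy => reachValue_le_of_step hG hk (step_of_nextDist_ne_zero hy)
  · rw [nextDist_min hk, positional_choice (s := ⟨s, hk⟩) (hf s hk).1, tsum_pure_mul]
    exact (hf s hk).2 hT
  · rw [nextDist_random hk, reachValue_random hG hT hk]

theorem hitWithin_le_reachValue (hG : G.FinitelyBranching) (hf : G.IsValueOptimal T f)
    (n : ℕ) (w : List S) (s : S) :
    G.hitWithin T σ (G.positional .minimizer f) n w s ≤ G.reachValue T s := by
  induction n generalizing w s with
  | zero => exact zero_le
  | succ n ih =>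
    by_cases hT : s ∈ T
    · rw [hitWithin_succ_of_mem hT, reachValue_target hG hT]
    · rw [hitWithin_succ_of_notMem hT]
      exact (ENNReal.tsum_le_tsum fun y => mul_le_mul_right (ih _ y) _).trans
        (tsum_nextDist_mul_reachValue_le hG hf w hT)

/-- The probability of visiting `T` when the play has passed through `w` and is now in `s`. -/
noncomputable def hitProb (G : StochasticGame S) (T : Set S) (σ : G.MaxStrategy)
    (π : G.MinStrategy) (w : List S) (s : S) : ℝ≥0∞ :=
  ⨆ n, G.hitWithin T σ π n w s

theorem hitProb_le_reachValue (hG : G.FinitelyBranching) (hf : G.IsValueOptimal T f)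
    (w : List S) (s : S) :
    G.hitProb T σ (G.positional .minimizer f) w s ≤ G.reachValue T s :=
  iSup_le fun n => hitWithin_le_reachValue hG hf n w s

theorem hitProb_le_tsum (w : List S) {s : S} (hT : s ∉ T) :
    G.hitProb T σ π w s ≤ ∑' y, G.nextDist σ π w s y * G.hitProb T σ π (w ++ [s]) y := by
  refine iSup_le fun n => ?_
  cases n with
  | zero => exact zero_le
  | succ n =>
    rw [hitWithin_succ_of_notMem hT]
    exact ENNReal.tsum_le_tsum fun y => mul_le_mul_right
      (le_iSup (fun n => G.hitWithin T σ π n (w ++ [s]) y) n) _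

end Positional

/-! ### Transfinite iteration and ranks. -/

section Ranking

universe u

variable {S : Type u}

/-- The transfinite iteration of an operator on sets, starting from the empty set. -/
def stage (N : Set S → Set S) (α : Ordinal.{u}) : Set S :=
  ⋃ β : Set.Iio α, N (stage N β.1)
termination_by α
decreasing_by exact β.2

theorem mem_stage {N : Set S → Set S} {α : Ordinal.{u}} {x : S} :
    x ∈ stage N α ↔ ∃ β < α, x ∈ N (stage N β) := by
  rw [stage]
  simp

/-- Otherwise each ordinal would contribute a new element, which would inject the ordinals into `S`.
-/
theorem exists_stage_closed (N : Set S → Set S) : ∃ α, N (stage N α) ⊆ stage N α := by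
  by_contra! h
  simp only [Set.not_subset] at h
  choose x hx hx' using h
  have hne : ∀ α β : Ordinal.{u}, α < β → x α ≠ x β := fun α β hαβ heq =>
    hx' β (heq ▸ mem_stage.2 ⟨α, hαβ, hx α⟩)
  refine not_injective_of_ordinal x fun α β heq => ?_
  rcases lt_trichotomy α β with h | h | h
  · exact absurd heq (hne _ _ h)
  · exact h
  · exact absurd heq.symm (hne _ _ h)

/-- The transfinite iteration of an operator ends in a closed set with a rank function. -/
theorem exists_rank (N : Set S → Set S) : ∃ (L : Set S) (ρ : S → Ordinal.{u}), N L ⊆ L ∧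
    ∀ x ∈ L, x ∈ N {y ∈ L | ρ y < ρ x} ∧ ∀ y ∈ N {y ∈ L | ρ y < ρ x}, y ∈ L ∧ ρ y ≤ ρ x := by
  obtain ⟨α, hα⟩ := exists_stage_closed N
  let ρ : S → Ordinal.{u} := fun x => sInf {β | x ∈ N (stage N β)}
  have hle : ∀ {x β}, x ∈ N (stage N β) → ρ x ≤ β := fun h => csInf_le' h
  have hL : ∀ {x}, x ∈ stage N α → ρ x < α ∧ x ∈ N (stage N (ρ x)) := by
    intro x hx
    obtain ⟨β, hβ, hxβ⟩ := mem_stage.1 hx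
    exact ⟨(hle hxβ).trans_lt hβ, csInf_mem (s := {β | x ∈ N (stage N β)}) ⟨β, hxβ⟩⟩
  -- As `ρ` records the first stage that produces an element, the members of smaller rank form
  -- exactly the stage from which `x` is produced.
  have heq : ∀ {x}, x ∈ stage N α → {y ∈ stage N α | ρ y < ρ x} = stage N (ρ x) := by
    intro x hx
    ext y
    constructor
    · rintro ⟨hy, hlt⟩
      exact mem_stage.2 ⟨ρ y, hlt, (hL hy).2⟩
    · intro hy
      obtain ⟨β, hβ, hyβ⟩ := mem_stage.1 hy
      exact ⟨mem_stage.2 ⟨β, hβ.trans (hL hx).1, hyβ⟩, (hle hyβ).trans_lt hβ⟩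
  refine ⟨stage N α, ρ, hα, fun x hx => ?_⟩
  rw [heq hx]
  exact ⟨(hL hx).2, fun y hy => ⟨mem_stage.2 ⟨ρ x, (hL hx).1, hy⟩, hle hy⟩⟩

end Ranking

/-! ### Regions where the minimizer cannot change the value. -/

section Indifferent

variable {S : Type*} {G : StochasticGame S} {f : S → S} {T Z U : Set S} {σ : G.MaxStrategy}

/-- In `Z \ T` the moves of the minimizer do not change the value, and only value-decreasing moves
of the maximizer leave `Z`. -/
structure IsIndifferent (G : StochasticGame S) (T Z : Set S) : Prop where
  max : ∀ x ∈ Z, x ∉ T → G.kind x = .maximizer → ∀ y, G.step x y →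
    G.reachValue T y = G.reachValue T x → y ∈ Z
  min : ∀ x ∈ Z, x ∉ T → G.kind x = .minimizer → ∀ y, G.step x y →
    G.reachValue T y = G.reachValue T x ∧ y ∈ Z
  random : ∀ x ∈ Z, x ∉ T → ∀ h : G.kind x = .random, ∀ y, G.prob ⟨x, h⟩ y ≠ 0 → y ∈ Z

/-- The transitions that do not change the value. -/
def preservingMoves (G : StochasticGame S) (T : Set S) (x : S) : Set S :=
  {y | G.step x y ∧ G.reachValue T y = G.reachValue T x}

/-- The value if the maximizer may only use value-preserving moves and loses in `U` and
outside `Z`. -/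
noncomputable def preservingValue (G : StochasticGame S) (T Z U : Set S) : S → ℝ≥0∞ :=
  G.value (G.preservingMoves T) T (U ∪ Zᶜ)

theorem preservingValue_le (x : S) : G.preservingValue T Z U x ≤ G.reachValue T x :=
  value_mono_moves (fun _ _ hy => hy.1) (Set.empty_subset _) x

/-- If every play through `U` loses value, then the plays that do not lose value reach `T` with
at most the probability that is possible with value-preserving moves outside `U`. -/
theorem hitWithin_le_preservingValue (hG : G.FinitelyBranching) (hZ : G.IsIndifferent T Z)
    (hf : G.IsValueOptimal T f)
    (hU : ∀ y ∈ U, ∀ w, G.hitProb T σ (G.positional .minimizer f) w y < G.reachValue T y)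
    (hfU : ∀ y ∈ Z, y ∉ T → y ∉ U → G.kind y = .minimizer →
      G.preservingValue T Z U (f y) ≤ G.preservingValue T Z U y)
    (n : ℕ) (w : List S) (s : S) (hs : s ∈ Z)
    (heq : G.hitProb T σ (G.positional .minimizer f) w s = G.reachValue T s) :
    G.hitWithin T σ (G.positional .minimizer f) n w s ≤ G.preservingValue T Z U s := by
  induction n generalizing w s with
  | zero => exact zero_le
  | succ n ih =>
    by_cases hT : s ∈ T
    · rw [hitWithin_succ_of_mem hT, preservingValue, ← bellman_value hG, bellman_target hT]
    have hsU : s ∉ U := fun h => (hU s h w).ne heq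
    have hD : s ∉ U ∪ Zᶜ := fun h => h.elim hsU fun h => h hs
    have h1 := hitProb_le_tsum (σ := σ) (π := G.positional .minimizer f) w hT
    have h2 := tsum_nextDist_mul_reachValue_le (σ := σ) hG hf w hT
    have h3 : ∑' y, G.nextDist σ (G.positional .minimizer f) w s y *
        G.hitProb T σ (G.positional .minimizer f) (w ++ [s]) y ≤
        ∑' y, G.nextDist σ (G.positional .minimizer f) w s y * G.reachValue T y :=
      ENNReal.tsum_le_tsum fun y => mul_le_mul_right (hitProb_le_reachValue hG hf _ y) _
    have hfin : G.reachValue T s ≠ ∞ := value_ne_top s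
    -- By `heq` the chain `h1`, `h3`, `h2` starts and ends at the same number, so equality holds
    -- throughout and passes to every successor that has positive probability.
    have hsupp : ∀ y, G.nextDist σ (G.positional .minimizer f) w s y ≠ 0 →
        G.hitProb T σ (G.positional .minimizer f) (w ++ [s]) y = G.reachValue T y := fun y hy =>
      eq_of_tsum_pmf_mul_le (fun z _ => hitProb_le_reachValue hG hf _ z)
        (ne_top_of_le_ne_top hfin (h3.trans h2)) (h2.trans (heq ▸ h1)) hy
    rw [hitWithin_succ_of_notMem hT]
    cases hk : G.kind s
    -- The same tightness shows that the maximizer uses value-preserving moves only, and these stay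
    -- in `Z`.
    · have hval : ∀ y, G.nextDist σ (G.positional .minimizer f) w s y ≠ 0 →
          G.reachValue T y = G.reachValue T s := fun y hy =>
        eq_of_tsum_pmf_mul_le (h := fun _ => G.reachValue T s)
          (fun z hz => reachValue_le_of_step hG hk (step_of_nextDist_ne_zero hz))
          (ne_top_of_le_ne_top hfin h2)
          (by rw [tsum_nextDist_mul_const, ← heq]; exact h1.trans h3) hy
      refine tsum_pmf_mul_le fun y hy => ?_
      have hstep := step_of_nextDist_ne_zero hy
      refine (ih _ y (hZ.max s hs hT hk y hstep (hval y hy)) (hsupp y hy)).trans ?_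
      conv_rhs => rw [preservingValue, ← bellman_value hG, bellman_max hT hD hk]
      exact le_iSup₂ (f := fun y _ => G.preservingValue T Z U y) y ⟨hstep, hval y hy⟩
    · have hstep := (hf s hk).1
      have hdist : G.nextDist σ (G.positional .minimizer f) w s = PMF.pure (f s) := by
        rw [nextDist_min hk, positional_choice (s := ⟨s, hk⟩) hstep]
      rw [hdist, tsum_pure_mul]
      exact (ih _ (f s) (hZ.min s hs hT hk _ hstep).2 (hsupp _ (by simp [hdist]))).trans
        (hfU s hs hT hsU hk)
    · conv_rhs => rw [preservingValue, ← bellman_value hG, bellman_random hT hD hk]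
      rw [nextDist_random hk] at hsupp ⊢
      refine ENNReal.tsum_le_tsum fun y => ?_
      rcases eq_or_ne (G.prob ⟨s, hk⟩ y) 0 with h0 | h0
      · simp [h0]
      · exact mul_le_mul_right (ih _ y (hZ.random s hs hT hk y h0) (hsupp y h0)) _

/-- The states of an indifferent set split into those where the minimizer can make the maximizer
fall short of the value and those where the value is guaranteed by value-preserving moves. -/
theorem exists_isValueOptimal_lt (hG : G.FinitelyBranching) (hZ : G.IsIndifferent T Z) :
    ∃ L : Set S, (∀ x ∈ L, x ∉ T) ∧
      (∀ x ∈ Z, x ∉ L → G.reachValue T x ≤ G.preservingValue T Z L x) ∧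
      ∃ f, G.IsValueOptimal T f ∧ ∀ (σ : G.MaxStrategy), ∀ x ∈ L, ∀ w,
        G.hitProb T σ (G.positional .minimizer f) w x < G.reachValue T x := by
  -- A state enters once its value cannot be secured by value-preserving moves that avoid the states
  -- already collected.
  obtain ⟨L, ρ, hNL, hρ⟩ := exists_rank fun U =>
    {x ∈ Z | G.preservingValue T Z U x < G.reachValue T x}
  have hLT : ∀ x ∈ L, x ∉ T := by
    intro x hx hT
    have hlt := (hρ x hx).1.2
    rw [reachValue_target hG hT, preservingValue, ← bellman_value hG, bellman_target hT] at hlt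
    exact lt_irrefl _ hlt
  refine ⟨L, hLT, fun x hxZ hxL => not_lt.1 fun hlt => hxL (hNL ⟨hxZ, hlt⟩), ?_⟩
  obtain ⟨g, hg⟩ := exists_isValueOptimal hG T
  -- On `L` the minimizer minimizes the preserving value in which the states of smaller rank are
  -- dead.
  choose m hm1 hm2 using fun x =>
    exists_step_forall_le hG (G.preservingValue T Z {y ∈ L | ρ y < ρ x}) x
  classical
  let f : S → S := fun x => if x ∈ L then m x else g x
  have hfL : ∀ x ∈ L, f x = m x := fun x hx => if_pos hx
  have hf : G.IsValueOptimal T f := by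
    intro x hk
    by_cases hx : x ∈ L
    · rw [hfL x hx]
      exact ⟨hm1 x, fun hT => (hZ.min x (hρ x hx).1.1 hT hk _ (hm1 x)).1.le⟩
    · simpa only [f, if_neg hx] using hg x hk
  refine ⟨f, hf, fun σ x => ?_⟩
  induction hα : ρ x using WellFoundedLT.induction generalizing x with
  | ind α ih =>
    subst hα
    intro hx w
    -- If the value were attained at `x`, plays would avoid smaller ranks, and the hitting
    -- probability would be at most the preserving value, which is too small at `x`.
    refine lt_of_le_of_ne (hitProb_le_reachValue hG hf w x) fun heq => ?_
    have hxN := (hρ x hx).1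
    refine (heq.symm.le.trans (iSup_le fun n => ?_)).not_gt hxN.2
    refine hitWithin_le_preservingValue hG hZ hf (fun y hy w => ih (ρ y) hy.2 y rfl hy.1 w)
      (fun y hyZ hyT hyU hk => ?_) n w x hxN.1 heq
    have hyD : y ∉ {y ∈ L | ρ y < ρ x} ∪ Zᶜ := fun h => h.elim hyU fun h => h hyZ
    -- If `y` falls short of its value, it has the rank of `x`, so `m y` minimizes the very same
    -- function. Otherwise the preserving value at `y` is the full value, which the move to `f y`
    -- does not change.
    by_cases hyN : G.preservingValue T Z {y ∈ L | ρ y < ρ x} y < G.reachValue T y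
    · obtain ⟨hyL, hyρ⟩ := (hρ x hx).2 y ⟨hyZ, hyN⟩
      have hρeq : ρ y = ρ x := hyρ.antisymm (not_lt.1 fun h => hyU ⟨hyL, h⟩)
      have hmy := hm2 y
      rw [hρeq] at hmy
      rw [hfL y hyL]
      conv_rhs => rw [preservingValue, ← bellman_value hG, bellman_min hyT hyD hk]
      exact le_iInf₂ hmy
    · calc _ ≤ G.reachValue T (f y) := preservingValue_le _
        _ = G.reachValue T y := (hZ.min y hyZ hyT hk _ (hf y hk).1).1
        _ ≤ _ := not_lt.1 hyN

theorem valueWithin_of_dead {A : S → Set S} {D : Set S} {x : S} (hT : x ∉ T) (hD : x ∈ D) (n : ℕ) :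
    G.valueWithin A T D n x = 0 := by
  cases n with
  | zero => rfl
  | succ n => exact bellman_dead hT hD

/-- Where value-preserving moves guarantee the value, a positional strategy does. -/
theorem exists_selector_preserving [Countable S] (hG : G.FinitelyBranching)
    (hZ : G.IsIndifferent T Z) {L : Set S} (hLT : ∀ x ∈ L, x ∉ T)
    (hL : ∀ x ∈ Z, x ∉ L → G.reachValue T x ≤ G.preservingValue T Z L x) :
    ∃ A : S → Set S, (∀ x, A x ⊆ {y | G.step x y}) ∧ ∃ f : S → S, ∀ x ∈ Z, x ∉ L →
      G.reachValue T x ≤ G.value (fixMoves A Set.univ f) T (L ∪ Zᶜ) x := by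
  let A : S → Set S := fun x =>
    {y ∈ G.preservingMoves T x | G.preservingValue T Z L y = G.preservingValue T Z L x}
  have heqL : ∀ x ∈ Z, x ∉ L → G.preservingValue T Z L x = G.reachValue T x :=
    fun x hx hxL => (preservingValue_le x).antisymm (hL x hx hxL)
  -- Dropping the moves outside `A` costs nothing: a value-preserving move from `Z \ L` stays in `Z
  -- \ L`, where both values agree, or enters `L`, where the payoff is 0.
  have hle : ∀ n x, G.valueWithin (G.preservingMoves T) T (L ∪ Zᶜ) n x ≤
      G.valueWithin A T (L ∪ Zᶜ) n x := by
    intro n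
    induction n with
    | zero => exact fun x => le_rfl
    | succ n ih =>
      intro x
      refine le_trans ?_ (bellman_mono ih x)
      rw [valueWithin_succ]
      rcases bellman_cases G T (L ∪ Zᶜ) x with
        hT | ⟨hT, hD⟩ | ⟨hT, hD, hk⟩ | ⟨hT, hD, hk⟩ | ⟨hT, hD, hk⟩
      · rw [bellman_target hT, bellman_target hT]
      · rw [bellman_dead hT hD, bellman_dead hT hD]
      · rw [bellman_max hT hD hk, bellman_max hT hD hk]
        have hxL : x ∉ L := fun h => hD (Or.inl h)
        have hxZ : x ∈ Z := not_not.1 fun h => hD (Or.inr h)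
        refine iSup₂_le fun y hy => ?_
        by_cases hyL : y ∈ L
        · rw [valueWithin_of_dead (hLT y hyL) (Or.inl hyL)]
          exact zero_le
        · have hyZ : y ∈ Z := hZ.max x hxZ hT hk y hy.1 hy.2
          refine le_iSup₂ (f := fun y _ => G.valueWithin (G.preservingMoves T) T (L ∪ Zᶜ) n y) y ?_
          exact ⟨hy, by rw [heqL y hyZ hyL, heqL x hxZ hxL]; exact hy.2⟩
      · rw [bellman_min hT hD hk, bellman_min hT hD hk]
      · rw [bellman_random hT hD hk, bellman_random hT hD hk]
  have heq : ∀ x, G.value A T (L ∪ Zᶜ) x = G.preservingValue T Z L x := fun x =>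
    (value_mono_moves (fun _ _ hy => hy.1) subset_rfl x).antisymm (iSup_mono fun n => hle n x)
  have hA : ∀ x, A x ⊆ {y | G.step x y} := fun x y hy => hy.1.1
  obtain ⟨f, hf⟩ := exists_selector_value_le (A := A) (T := T) (D := L ∪ Zᶜ) hG hA
    fun x _ y hy => by rw [heq, heq]; exact hy.2
  exact ⟨A, hA, f, fun x hx hxL => (hL x hx hxL).trans ((heq x).symm.le.trans (hf x))⟩

/-- The minimizer can never lower the value and 1 cannot be exceeded; a mean equal to 1 forces 1 on
the support. -/
theorem isIndifferent_value_one (hG : G.FinitelyBranching) (T : Set S) :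
    G.IsIndifferent T {x | G.reachValue T x = 1} where
  max _ hx _ _ _ _ heq := heq.trans hx
  min x hx hT hk y hy := by
    have h1 : G.reachValue T y = 1 :=
      (value_le_one y).antisymm (hx.symm.le.trans (le_reachValue_of_step hG hT hk hy))
    exact ⟨h1.trans hx.symm, h1⟩
  random x hx hT hk y hy := by
    have hsum : ∑' y, G.prob ⟨x, hk⟩ y * G.reachValue T y = 1 :=
      (reachValue_random hG hT hk).symm.trans hx
    exact eq_of_tsum_pmf_mul_le (g := G.reachValue T) (h := fun _ => 1) (fun z _ => value_le_one z)
      (by simp [hsum]) (by simp [hsum, PMF.tsum_coe]) hy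

end Indifferent

/-! ### Comparison of the value with the threshold. -/

section Determinacy

variable {S : Type*} [Countable S] [MeasurableSpace S] [DiscreteMeasurableSpace S]
  {G : StochasticGame S} {T D : Set S} {f : S → S}

theorem value_le_playMeasure {A : S → Set S} (hA : ∀ x, A x ⊆ {y | G.step x y})
    (π : G.MinStrategy) (s : S) : G.value (fixMoves A Set.univ f) T D s ≤
      G.playMeasure s (G.positional .maximizer f) π (reach T) := by
  rw [playMeasure_reach]
  exact iSup_mono fun n => valueWithin_le_hitWithin hA n [] s

theorem playMeasure_le_reachValue (hG : G.FinitelyBranching) (hf : G.IsValueOptimal T f)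
    (σ : G.MaxStrategy) (s : S) :
    G.playMeasure s σ (G.positional .minimizer f) (reach T) ≤ G.reachValue T s := by
  rw [playMeasure_reach]
  exact hitProb_le_reachValue hG hf [] s

/-- The bound `t'` does not depend on `π`, so strictness survives the infimum over `π`. -/
theorem exists_md_lt_playMeasure (hG : G.FinitelyBranching) {s : S} {t : ℝ≥0∞}
    (ht : t < G.reachValue T s) :
    ∃ σ : G.MaxStrategy, σ.IsMD ∧ ∃ t' > t, ∀ π : G.MinStrategy,
      t' ≤ G.playMeasure s σ π (reach T) := by
  obtain ⟨f, -, hf, -⟩ := exists_selector_lt_value (fun x => hG x) ht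
  exact ⟨G.positional .maximizer f, positional_isMD, _, hf,
    fun π => value_le_playMeasure (fun _ => subset_rfl) π s⟩

/-- This identifies the iterated value with the game value, so that the hypotheses on transitions
become statements about `reachValue`. -/
theorem hasValue_reachValue (hG : G.FinitelyBranching) (T : Set S) (s : S) :
    G.HasValue (reach T) s (G.reachValue T s) := by
  obtain ⟨f, hf⟩ := exists_isValueOptimal hG T
  have h1 : G.reachValue T s ≤
      ⨆ σ : G.MaxStrategy, ⨅ π : G.MinStrategy, G.playMeasure s σ π (reach T) := by
    refine le_of_forall_lt fun t ht => ?_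
    obtain ⟨σ, -, t', ht', h⟩ := exists_md_lt_playMeasure hG ht
    exact ht'.trans_le ((le_iInf h).trans
      (le_iSup (fun σ => ⨅ π : G.MinStrategy, G.playMeasure s σ π (reach T)) σ))
  have h2 : (⨅ π : G.MinStrategy, ⨆ σ : G.MaxStrategy, G.playMeasure s σ π (reach T)) ≤
      G.reachValue T s :=
    (iInf_le _ (G.positional .minimizer f)).trans
      (iSup_le fun σ => playMeasure_le_reachValue hG hf σ s)
  have h3 := iSup_iInf_le_iInf_iSup
    fun (σ : G.MaxStrategy) (π : G.MinStrategy) => G.playMeasure s σ π (reach T)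
  exact ⟨(h3.trans h2).antisymm h1, h2.antisymm (h1.trans h3)⟩

/-- At a state of an indifferent set, the maximizer can guarantee the value with an MD strategy or
the minimizer can avoid it with an MD strategy. -/
theorem IsIndifferent.exists_md (hG : G.FinitelyBranching) {Z : Set S} (hZ : G.IsIndifferent T Z)
    {s : S} (hs : s ∈ Z) :
    (∃ σ : G.MaxStrategy, σ.IsMD ∧ ∀ π : G.MinStrategy,
      G.reachValue T s ≤ G.playMeasure s σ π (reach T)) ∨
    (∃ π : G.MinStrategy, π.IsMD ∧ ∀ σ : G.MaxStrategy,
      G.playMeasure s σ π (reach T) < G.reachValue T s) := by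
  obtain ⟨L, hLT, hL, f, -, hf⟩ := exists_isValueOptimal_lt hG hZ
  by_cases hsL : s ∈ L
  · refine Or.inr ⟨G.positional .minimizer f, positional_isMD, fun σ => ?_⟩
    rw [playMeasure_reach]
    exact hf σ s hsL []
  · obtain ⟨A, hA, g, hg⟩ := exists_selector_preserving hG hZ hLT hL
    exact Or.inl ⟨G.positional .maximizer g, positional_isMD,
      fun π => (hg s hs hsL).trans (value_le_playMeasure hA π s)⟩

theorem isIndifferent_univ (hG : G.FinitelyBranching)
    (h : ∀ s s', G.kind s = .minimizer → G.step s s' → ¬ G.ValueIncreasing (reach T) s s') :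
    G.IsIndifferent T Set.univ where
  max _ _ _ _ _ _ _ := trivial
  min x _ hT hk y hy := by
    refine ⟨le_antisymm (not_lt.1 fun hlt => ?_) (le_reachValue_of_step hG hT hk hy), trivial⟩
    exact h x y hk hy ⟨_, _, hasValue_reachValue hG T x, hasValue_reachValue hG T y, hlt⟩
  random _ _ _ _ _ _ := trivial

/-- A maximizer without value-decreasing moves has an optimal MD strategy. -/
theorem exists_md_optimal (hG : G.FinitelyBranching)
    (h : ∀ s s', G.kind s = .maximizer → G.step s s' → ¬ G.ValueDecreasing (reach T) s s')
    (s : S) : ∃ σ : G.MaxStrategy, σ.IsMD ∧ ∀ π : G.MinStrategy,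
      G.reachValue T s ≤ G.playMeasure s σ π (reach T) := by
  obtain ⟨f, hf⟩ := exists_selector_value_le (A := G.successors) (T := T) (D := ∅) hG
    (fun _ => subset_rfl) fun x hk y hy =>
      le_antisymm (reachValue_le_of_step hG hk hy) (not_lt.1 fun hlt => h x y hk hy
        ⟨_, _, hasValue_reachValue hG T x, hasValue_reachValue hG T y, hlt⟩)
  exact ⟨G.positional .maximizer f, positional_isMD,
    fun π => (hf s).trans (value_le_playMeasure (fun _ => subset_rfl) π s)⟩

/-- Determinacy for `≥` follows from determinacy at the states whose value is the threshold. -/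
theorem stronglyMDDetermined_ge (hG : G.FinitelyBranching) {c : ℝ≥0∞}
    (h : ∀ s, G.reachValue T s = c →
      (∃ σ : G.MaxStrategy, σ.IsMD ∧ ∀ π : G.MinStrategy,
        G.reachValue T s ≤ G.playMeasure s σ π (reach T)) ∨
      (∃ π : G.MinStrategy, π.IsMD ∧ ∀ σ : G.MaxStrategy,
        G.playMeasure s σ π (reach T) < G.reachValue T s)) :
    G.StronglyMDDetermined (reach T) .ge c := by
  intro s
  rcases lt_trichotomy (G.reachValue T s) c with hlt | heq | hgt
  · obtain ⟨f, hf⟩ := exists_isValueOptimal hG T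
    exact Or.inr ⟨G.positional .minimizer f, positional_isMD,
      fun σ => not_le.2 ((playMeasure_le_reachValue hG hf σ s).trans_lt hlt)⟩
  · refine (h s heq).imp ?_ ?_
    · rintro ⟨σ, hσ, hle⟩
      exact ⟨σ, hσ, fun π => heq.symm.le.trans (hle π)⟩
    · rintro ⟨π, hπ, hlt⟩
      exact ⟨π, hπ, fun σ => not_le.2 ((hlt σ).trans_eq heq)⟩
  · obtain ⟨σ, hσ, t, ht, hle⟩ := exists_md_lt_playMeasure hG hgt
    exact Or.inl ⟨σ, hσ, fun π => ht.le.trans (hle π)⟩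

/-- Equality is harmless here: a value-optimal minimizer keeps the probability at most the value,
which already refutes `>`. -/
theorem stronglyMDDetermined_gt (hG : G.FinitelyBranching) (T : Set S) (c : ℝ≥0∞) :
    G.StronglyMDDetermined (reach T) .gt c := by
  intro s
  rcases lt_or_ge c (G.reachValue T s) with hlt | hle
  · obtain ⟨σ, hσ, t, ht, hle⟩ := exists_md_lt_playMeasure hG hlt
    exact Or.inl ⟨σ, hσ, fun π => ht.trans_le (hle π)⟩
  · obtain ⟨f, hf⟩ := exists_isValueOptimal hG T
    exact Or.inr ⟨G.positional .minimizer f, positional_isMD,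
      fun σ => not_lt.2 ((playMeasure_le_reachValue hG hf σ s).trans hle)⟩

end Determinacy
end StochasticGame

theorem theorem5 {S : Type*} [Countable S] [MeasurableSpace S] [DiscreteMeasurableSpace S]
    (G : StochasticGame S) (hG : G.FinitelyBranching) (T : Set S)
    (r : StochasticGame.ThresholdRel) (c : ℝ≥0) (hc : c ≤ 1)
    (h : (∀ s s', G.kind s = .maximizer → G.step s s' →
            ¬ G.ValueDecreasing (StochasticGame.reach T) s s') ∨
         (∀ s s', G.kind s = .minimizer → G.step s s' →
            ¬ G.ValueIncreasing (StochasticGame.reach T) s s') ∨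
         (r = .ge ∧ c = 1) ∨
         r = .gt) :
    G.StronglyMDDetermined (StochasticGame.reach T) r c := by
  cases r with
  | gt => exact StochasticGame.stronglyMDDetermined_gt hG T c
  | ge =>
    refine StochasticGame.stronglyMDDetermined_ge hG fun s hs => ?_
    rcases h with h | h | ⟨-, rfl⟩ | h
    · exact Or.inl (StochasticGame.exists_md_optimal hG h s)
    · exact (StochasticGame.isIndifferent_univ hG h).exists_md hG trivial
    · exact (StochasticGame.isIndifferent_value_one hG T).exists_md hG (by simpa using hs)
    · cases h
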